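/- **Setting.** All functions are real-valued functions of $t\in\mathbb R$. For a $1$-periodic $g$ let $\mathcal F(g)(k)=\int_0^1 g(t)e^{-2\pi i k t}\,dt$ and $\|\mathcal F(g)\|_1=\sum_{k\in\mathbb Z}|\mathcal F(g)(k)|$; let $V_M=\operatorname{span}\{e^{2\pi i k t}:|k|\le M\}$, with orthogonal projection $P_{V_M}$. For a differentiable phase function $\theta$ put $$L_\theta=\frac{\theta(1)-\theta(0)}{2\pi},\qquad \bar\theta=\frac{\theta-\theta(0)}{2\pi L_\theta},\qquad \widehat g_\theta(\omega)=\int_0^1 g\,e^{-2\pi i\omega\bar\theta}\,d\bar\theta .$$ **Algorithm.** Let $f$ be a $1$-periodic signal, known for all $t$. Given $\theta$, set, with $\chi$ the indicator function of $(-\tfrac12,\tfrac12)$, $$a=\sum_{k\in\mathbb Z}\big(\widehat f_\theta(k+L_\theta)+\widehat f_\theta(k-L_\theta)\big)\chi(k/L_\theta)e^{2\pi i k\bar\theta},\qquad b=\sum_{k\in\mathbb Z}-i\big(\widehat f_\theta(k+L_\theta)-\widehat f_\theta(k-L_\theta)\big)\chi(k/L_\theta)e^{2\pi i k\bar\theta},$$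 $$\Delta\theta'=P_{V_{M_0}}\Big(\frac{d}{dt}\arctan\frac ba\Big)\ \text{ with }\ \frac{d}{dt}\arctan\frac ba=\frac{ab'-ba'}{a^2+b^2},\qquad \Delta\theta(t)=\int_0^t\Delta\theta'(s)\,ds .$$ The next phase function is $\theta+\beta\Delta\theta$ with $\beta=\max\{\alpha\in[0,1]:(\theta+\alpha\Delta\theta)'\ge0\text{ on }[0,1]\}$. Starting from $\theta^0$ this defines $\theta^m$, $m\ge0$; denote by $a^m,b^m$ the functions $a,b$ computed from $\theta^m$. **Theorem.** Let $M_0,M_1\ge0$ be integers and let $c,\kappa>0$ and $C$ be real. There is $\eta_0>0$, depending only on $M_0,M_1,c,\kappa,C$, such that the following holds. Let $f=f_0+f_1\cos\theta$ be $1$-periodic, where $f_0,f_1$ are continuous and $1$-periodic, $f_1>0$, $\theta$ is differentiable and $\theta'>0$. Put $L=L_\theta$. Assume that * $\theta'\in V_{M_0}$, and $\widehat{f_0}_\theta(k)=\widehat{f_1}_\theta(k)=0$ for all integers $|k|>M_1$; * $\bar\theta'\ge c$, $f_1\ge\kappa$, and $|\widehat{f_0}_\theta(k)|\le C$, $|\widehat{f_1}_\theta(k)|\le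 C$ for all $k\in\mathbb Z$; * $L\ge\eta_0$. Let $\theta^0$ be a differentiable function with $(\theta^0)'\in V_{M_0}$, $L_{\theta^0}\in\mathbb Z$ and $$\|\mathcal F((\theta^0-\theta)')\|_1\le \pi M_0/2 .$$ Then $(\theta^m)'>0$ and $(a^m)^2+(b^m)^2>0$ everywhere for all $m\ge0$, and $$\|\mathcal F((\theta^{m+1}-\theta)')\|_1\le\tfrac12\|\mathcal F((\theta^m-\theta)')\|_1\qquad(m\ge0).$$ Consequently the iteration converges to the exact decomposition: as $m\to\infty$, $\|\mathcal F((\theta^m-\theta)')\|_1\to0$ and, uniformly in $t$, $$f-\big(a^m\cos(2\pi L_{\theta^m}\overline{\theta^m})-b^m\sin(2\pi L_{\theta^m}\overline{\theta^m})\big)\to f_0,\qquad \sqrt{(a^m)^2+(b^m)^2}\to f_1 .$$ -/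

import Mathlib

open Complex (I)

noncomputable section

namespace SparseTF

/-- The space `V_M = span {e^{i 2 k π t} : |k| ≤ M}` (the period is normalized to `1`). -/
def trigSpan (M : ℕ) : Submodule ℂ (ℝ → ℂ) :=
  Submodule.span ℂ
    {e | ∃ k : ℤ, |k| ≤ (M : ℤ) ∧ e = fun t : ℝ => Complex.exp (2 * Real.pi * I * k * t)}

/-- The Fourier coefficients `𝓕(g)(k) = ∫₀¹ g(t) e^{-i 2 k π t} dt` in the physical coordinate. -/
def physCoeff (g : ℝ → ℝ) (k : ℤ) : ℂ :=
  fourierCoeffOn (zero_lt_one : (0 : ℝ) < 1) (fun t => (g t : ℂ)) k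

/-- `‖𝓕(g)‖₁`, the `ℓ¹` norm of the Fourier coefficients, as an extended nonnegative real
(so that no summability convention intervenes). -/
def fourierL1 (g : ℝ → ℝ) : ENNReal := ∑' k : ℤ, ‖physCoeff g k‖ₑ

/-- The (orthogonal) projection onto `V_M`. The sum is real because `g` is real-valued. -/
def projV (M : ℕ) (g : ℝ → ℝ) (t : ℝ) : ℝ :=
  (∑ k ∈ Finset.Icc (-(M : ℤ)) (M : ℤ),
    physCoeff g k * Complex.exp (2 * Real.pi * I * k * t)).re

/-- The number of periods `L_θ = (θ(1) - θ(0)) / 2π`. -/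
def numPeriods (θ : ℝ → ℝ) : ℝ := (θ 1 - θ 0) / (2 * Real.pi)

/-- The normalized phase `θ̄ = (θ - θ(0)) / (2π L_θ)`. -/
def normPhase (θ : ℝ → ℝ) (t : ℝ) : ℝ := (θ t - θ 0) / (2 * Real.pi * numPeriods θ)

/-- The Fourier transform in the `θ̄`-coordinate: `∫₀¹ g e^{-i 2 π ω θ̄} dθ̄`. -/
def phaseCoeff (θ g : ℝ → ℝ) (ω : ℝ) : ℂ :=
  ∫ t in (0 : ℝ)..1,
    (g t : ℂ) * Complex.exp (-(2 * Real.pi * I * ω * normPhase θ t)) * (deriv (normPhase θ) t : ℝ)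

/-- The cutoff function, the indicator of `(-1/2, 1/2)`. -/
def cutoff (x : ℝ) : ℂ := if -(1 / 2) < x ∧ x < 1 / 2 then 1 else 0

/-- The in-phase envelope
`a = 𝓕_θ⁻¹[(f̂_θ(ω + L_θ) + f̂_θ(ω - L_θ)) χ(ω / L_θ)]`, a function of `t`.
For `L_θ > 0` the sum has finitely many nonzero terms and is real, since `f` is. -/
def envA (f θ : ℝ → ℝ) (t : ℝ) : ℝ :=
  (∑' k : ℤ, (phaseCoeff θ f (k + numPeriods θ) + phaseCoeff θ f (k - numPeriods θ))
    * cutoff (k / numPeriods θ) * Complex.exp (2 * Real.pi * I * k * normPhase θ t)).re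

/-- The quadrature envelope
`b = 𝓕_θ⁻¹[-i (f̂_θ(ω + L_θ) - f̂_θ(ω - L_θ)) χ(ω / L_θ)]`, a function of `t`. -/
def envB (f θ : ℝ → ℝ) (t : ℝ) : ℝ :=
  (∑' k : ℤ, -I * (phaseCoeff θ f (k + numPeriods θ) - phaseCoeff θ f (k - numPeriods θ))
    * cutoff (k / numPeriods θ) * Complex.exp (2 * Real.pi * I * k * normPhase θ t)).re

/-- `d/dt arctan(b/a)`, written `(a b' - b a') / (a² + b²)`: the derivative of a continuous
branch of the angle of the point `(a, b)`, which also makes sense where `a` vanishes.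
See `hasDerivAt_arctan_div`. -/
def angleDeriv (a b : ℝ → ℝ) (t : ℝ) : ℝ :=
  (a t * deriv b t - b t * deriv a t) / (a t ^ 2 + b t ^ 2)

theorem hasDerivAt_arctan_div {a b : ℝ → ℝ} {t : ℝ} (ha : DifferentiableAt ℝ a t)
    (hb : DifferentiableAt ℝ b t) (h0 : a t ≠ 0) :
    HasDerivAt (fun s => Real.arctan (b s / a s)) (angleDeriv a b t) t := by
  have h := (hb.hasDerivAt.div ha.hasDerivAt h0).arctan
  have h1 : a t ^ 2 + b t ^ 2 ≠ 0 := by positivity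
  have h2 : 1 / (1 + (b / a) t ^ 2) * ((deriv b t * a t - b t * deriv a t) / a t ^ 2)
      = angleDeriv a b t := by
    rw [Pi.div_apply]
    unfold angleDeriv
    field_simp
  exact h2 ▸ h

/-- The frequency update `Δθ' = P_{V_M}(d/dt arctan(b/a))`. -/
def freqUpdate (M : ℕ) (f θ : ℝ → ℝ) : ℝ → ℝ :=
  projV M (angleDeriv (envA f θ) (envB f θ))

/-- The phase update `Δθ(t) = ∫₀ᵗ Δθ'(s) ds`. -/
def phaseUpdate (M : ℕ) (f θ : ℝ → ℝ) (t : ℝ) : ℝ := ∫ s in (0 : ℝ)..t, freqUpdate M f θ s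

/-- The step length `β = max {α ∈ [0,1] : (θ + α Δθ)' ≥ 0 on [0,1]}`. -/
def stepLength (M : ℕ) (f θ : ℝ → ℝ) : ℝ :=
  sSup {α : ℝ | α ∈ Set.Icc (0 : ℝ) 1 ∧
    ∀ t ∈ Set.Icc (0 : ℝ) 1, 0 ≤ deriv (fun s => θ s + α * phaseUpdate M f θ s) t}

/-- One iteration of the algorithm: `θ ↦ θ + β Δθ`. -/
def nextPhase (M : ℕ) (f θ : ℝ → ℝ) (t : ℝ) : ℝ :=
  θ t + stepLength M f θ * phaseUpdate M f θ t

/-- The `m`-th iterate `θ^m` for the signal `f` and the initial guess `θ0`. -/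
def phaseIter (M : ℕ) (f θ0 : ℝ → ℝ) (m : ℕ) : ℝ → ℝ := (nextPhase M f)^[m] θ0

/-- The envelope `√(a² + b²)` extracted from `f` with the phase function `θ`. -/
def extractedEnvelope (f θ : ℝ → ℝ) (t : ℝ) : ℝ :=
  Real.sqrt (envA f θ t ^ 2 + envB f θ t ^ 2)

/-- The oscillatory component `a cos(2π L_θ θ̄) - b sin(2π L_θ θ̄)` extracted from `f`. -/
def extractedMode (f θ : ℝ → ℝ) (t : ℝ) : ℝ :=
  envA f θ t * Real.cos (2 * Real.pi * numPeriods θ * normPhase θ t)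
    - envB f θ t * Real.sin (2 * Real.pi * numPeriods θ * normPhase θ t)

end SparseTF

end

open SparseTF

/-! Let `φ` be the current phase, `u` its normalization, `N` its integer number of periods, `ψ = θ -
φ + φ 0` the phase error and `δ = ‖𝓕((φ - θ)')‖₁`. Then `f = f₀ + ½ f₁ e^{iψ} e^{2πiNu} + ½ f₁
e^{-iψ} e^{-2πiNu}`. Shifting the spectrum by `±N` and cutting off at `N/2` returns `f₁ cos ψ` and
`f₁ sin ψ`, up to the Fourier tails beyond `N/2`, in the coordinate `u`, of `f₀` and `f₁ e^{±iψ}`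
(`norm_demodulation_sub_le`).

The crux is that these tails are at most `ε δ`, and not merely `ε`, for large `N`
(`exists_highTail_modulated`). Replacing the normalized `θ` by `u` and `ψ` by `ψ 0` in the finite
expansions of `f₀` and `f₁ e^{±iψ}` gives trigonometric polynomials in `u`, which have no high
frequencies. What was subtracted has a derivative of size `O(δ)`, and the tail of a `C¹` function is
a small multiple of the bound on its derivative (`exists_warpCoeff_tail_le`). Hence the envelopes
are exact up to `ε δ` (`exists_envelope_close`).

The angle of `(a, b)` therefore differs from `ψ` by a periodic function of size `O(ε δ / κ)`.
Differentiation multiplies its `k`-th coefficient by `2πik`, and only `|k| ≤ M₀` survives the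
projection, so no bound on `a'` or `b'` is needed (`norm_physCoeff_angleDeriv_sub_le`). The update
is `θ' - φ' + R` with `‖𝓕 R‖₁ ≤ δ/2`.

For large `L`, `θ'` exceeds every admissible error. Thus the full step is allowed and the new
frequency is `θ' + R > 0`. Since `R` has mean zero, the new number of periods is exactly that of
`θ`, an integer, and the step can be repeated (`exists_step`). -/

namespace SparseTF

/-! ### Changes of variables of the circle and their exponentials -/

/-- A `C¹` change of variables of the circle `ℝ / ℤ` of degree one that fixes `0`. -/
structure IsWarp (u : ℝ → ℝ) : Prop where
  differentiable : Differentiable ℝ u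
  continuous_deriv : Continuous (deriv u)
  deriv_pos : ∀ t, 0 < deriv u t
  map_zero : u 0 = 0
  map_add_one : ∀ t, u (t + 1) = u t + 1

/-- The exponential `e^{2πiku}`. -/
noncomputable def wave (u : ℝ → ℝ) (k : ℤ) (t : ℝ) : ℂ :=
  Complex.exp (2 * Real.pi * I * k * u t)

/-- The Fourier coefficients with respect to the coordinate `u`. -/
noncomputable def warpCoeff (u : ℝ → ℝ) (g : ℝ → ℂ) (k : ℤ) : ℂ :=
  ∫ t in (0 : ℝ)..1, g t * Complex.exp (-(2 * Real.pi * I * k * u t)) * (deriv u t : ℝ)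

section wave

variable {u : ℝ → ℝ}

theorem wave_add (k l : ℤ) (t : ℝ) : wave u (k + l) t = wave u k t * wave u l t := by
  unfold wave
  rw [← Complex.exp_add]
  push_cast
  ring_nf

theorem wave_eq_exp_ofReal_mul_I (k : ℤ) (t : ℝ) :
    wave u k t = Complex.exp (((2 * Real.pi * k * u t : ℝ) : ℂ) * I) := by
  unfold wave
  push_cast
  ring_nf

theorem norm_wave (k : ℤ) (t : ℝ) : ‖wave u k t‖ = 1 := by
  rw [wave_eq_exp_ofReal_mul_I, Complex.norm_exp_ofReal_mul_I]

theorem wave_neg (k : ℤ) (t : ℝ) :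
    wave u (-k) t = Complex.exp (-(2 * Real.pi * I * k * u t)) := by
  unfold wave
  push_cast
  ring_nf

theorem wave_eq_fourier (k : ℤ) (t : ℝ) :
    wave u k t = fourier k ((u t : ℝ) : AddCircle (1 : ℝ)) := by
  rw [fourier_coe_apply]
  unfold wave
  push_cast
  ring_nf

theorem warpCoeff_eq_integral_wave (g : ℝ → ℂ) (k : ℤ) :
    warpCoeff u g k = ∫ t in (0 : ℝ)..1, g t * wave u (-k) t * (deriv u t : ℝ) := by
  simp only [wave_neg, warpCoeff]

end wave

namespace IsWarp

variable {u : ℝ → ℝ}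

theorem continuous (hu : IsWarp u) : Continuous u := hu.differentiable.continuous

theorem strictMono (hu : IsWarp u) : StrictMono u :=
  strictMono_of_deriv_pos hu.deriv_pos

theorem map_intCast (hu : IsWarp u) (n : ℤ) : u n = n := by
  have hp : Function.Periodic (fun t => u t - t) 1 := fun t => by
    simp only [hu.map_add_one]; ring
  have := hp.int_mul n 0
  simp only [mul_one, zero_add, hu.map_zero] at this
  linarith

theorem surjective (hu : IsWarp u) : Function.Surjective u := by
  intro y
  have h := intermediate_value_Icc (a := ((⌊y⌋ : ℤ) : ℝ)) (b := (⌊y⌋ : ℝ) + 1) (by linarith)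
    hu.continuous.continuousOn
  rw [hu.map_add_one, hu.map_intCast] at h
  obtain ⟨t, -, ht⟩ := h ⟨Int.floor_le y, (Int.lt_floor_add_one y).le⟩
  exact ⟨t, ht⟩

theorem map_one (hu : IsWarp u) : u 1 = 1 := by simpa using hu.map_intCast 1

/-- The inverse of a change of variables of the circle. -/
theorem exists_inverse (hu : IsWarp u) : ∃ v : ℝ → ℝ, IsWarp v ∧ (∀ x, u (v x) = x) ∧
    (∀ t, v (u t) = t) ∧ ∀ x, HasDerivAt v (deriv u (v x))⁻¹ x := by
  set e := hu.strictMono.orderIsoOfSurjective u hu.surjective with he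
  have h1 : ∀ x, u (e.symm x) = x := fun x =>
    StrictMono.orderIsoOfSurjective_self_symm_apply u hu.strictMono hu.surjective x
  have h2 : ∀ t, e.symm (u t) = t := fun t =>
    StrictMono.orderIsoOfSurjective_symm_apply_self u hu.strictMono hu.surjective t
  have hd : ∀ x, HasDerivAt (fun x => e.symm x) (deriv u (e.symm x))⁻¹ x := fun x =>
    HasDerivAt.of_local_left_inverse e.symm.continuous.continuousAt
      (hu.differentiable (e.symm x)).hasDerivAt (hu.deriv_pos _).ne'
      (Filter.Eventually.of_forall h1)
  have hderiv : deriv (fun x => e.symm x) = fun x => (deriv u (e.symm x))⁻¹ :=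
    funext fun x => (hd x).deriv
  refine ⟨fun x => e.symm x, ⟨fun x => (hd x).differentiableAt, ?_, ?_, ?_, ?_⟩, h1, h2, hd⟩
  · rw [hderiv]
    exact (hu.continuous_deriv.comp e.symm.continuous).inv₀ fun x => (hu.deriv_pos _).ne'
  · intro x
    rw [hderiv]
    exact inv_pos.2 (hu.deriv_pos _)
  · simpa [hu.map_zero] using h2 0
  · intro x
    apply hu.strictMono.injective
    rw [hu.map_add_one, h1, h1]

theorem id : IsWarp (fun t => t) where
  differentiable := differentiable_id
  continuous_deriv := by simpa using continuous_const
  deriv_pos t := by simp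
  map_zero := rfl
  map_add_one _ := rfl

theorem wave_periodic (hu : IsWarp u) (k : ℤ) : Function.Periodic (wave u k) 1 := by
  intro t
  rw [wave_eq_fourier, wave_eq_fourier, hu.map_add_one, AddCircle.coe_add, AddCircle.coe_period,
    add_zero]

theorem hasDerivAt_wave (hu : IsWarp u) (k : ℤ) (t : ℝ) :
    HasDerivAt (wave u k) (wave u k t * (2 * Real.pi * I * k * (deriv u t : ℝ))) t := by
  have := ((hu.differentiable t).hasDerivAt.ofReal_comp.const_mul (2 * Real.pi * I * k : ℂ)).cexp
  exact this

theorem continuous_wave (hu : IsWarp u) (k : ℤ) : Continuous (wave u k) :=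
  continuous_iff_continuousAt.2 fun t => (hu.hasDerivAt_wave k t).continuousAt

end IsWarp

/-! ### Fourier series in a warped coordinate -/

theorem fourierCoeffOn_zero_one_eq (g : ℝ → ℂ) (k : ℤ) :
    fourierCoeffOn (zero_lt_one : (0 : ℝ) < 1) g k
      = ∫ x in (0 : ℝ)..1, g x * Complex.exp (-(2 * Real.pi * I * k * x)) := by
  rw [fourierCoeffOn_eq_integral]
  simp only [sub_zero, div_one, one_smul]
  refine intervalIntegral.integral_congr fun x _ => ?_
  simp only [smul_eq_mul]
  rw [fourier_coe_apply, mul_comm]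
  congr 2
  push_cast
  ring

theorem physCoeff_eq_warpCoeff (g : ℝ → ℝ) (k : ℤ) :
    physCoeff g k = warpCoeff (fun t => t) (fun t => (g t : ℂ)) k := by
  rw [physCoeff, fourierCoeffOn_zero_one_eq, warpCoeff]
  simp

/-- The substitution `x = u t` absorbs the factor `deriv u`. Through it, convergence, orthogonality
and Parseval carry over to the coordinate `u` from the ordinary theory. -/
theorem warpCoeff_eq_fourierCoeffOn {u v : ℝ → ℝ} (hu : IsWarp u) (hv : Continuous v)
    (hvu : ∀ t, v (u t) = t) {g : ℝ → ℂ} (hg : Continuous g) (k : ℤ) :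
    warpCoeff u g k = fourierCoeffOn (zero_lt_one : (0 : ℝ) < 1) (fun x => g (v x)) k := by
  rw [fourierCoeffOn_zero_one_eq]
  have h := intervalIntegral.integral_deriv_smul_comp (a := 0) (b := 1) (f := u) (f' := deriv u)
    (g := fun x => g (v x) * Complex.exp (-(2 * Real.pi * I * k * x)))
    (fun x _ => (hu.differentiable x).hasDerivAt) hu.continuous_deriv.continuousOn
    (by fun_prop)
  rw [hu.map_zero, hu.map_one] at h
  rw [← h, warpCoeff]
  refine intervalIntegral.integral_congr fun t _ => ?_
  simp only [Function.comp, hvu, Complex.real_smul]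
  ring

theorem fourierCoeff_lift_eq {G : ℝ → ℂ} (hp : Function.Periodic G 1) (k : ℤ) :
    fourierCoeff (hp.lift : AddCircle (1 : ℝ) → ℂ) k
      = fourierCoeffOn (zero_lt_one : (0 : ℝ) < 1) G k := by
  rw [fourierCoeff_eq_intervalIntegral _ _ 0, fourierCoeffOn_eq_integral]
  simp

/-- The Fourier series in the coordinate `u` converges to the function if it does so absolutely. -/
theorem hasSum_warpCoeff {u : ℝ → ℝ} (hu : IsWarp u) {g : ℝ → ℂ} (hg : Continuous g)
    (hp : Function.Periodic g 1) (hs : Summable (warpCoeff u g)) (t : ℝ) :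
    HasSum (fun k => warpCoeff u g k * wave u k t) (g t) := by
  obtain ⟨v, hv, huv, hvu, -⟩ := hu.exists_inverse
  have hp' : Function.Periodic (fun x => g (v x)) 1 := fun x => by
    simp only [hv.map_add_one, hp (v x)]
  have hc : Continuous (hp'.lift : AddCircle (1 : ℝ) → ℂ) :=
    continuous_coinduced_dom.2 (hg.comp hv.continuous)
  have hco : ∀ k, fourierCoeff (⟨hp'.lift, hc⟩ : C(AddCircle (1 : ℝ), ℂ)) k = warpCoeff u g k := by
    intro k
    rw [warpCoeff_eq_fourierCoeffOn hu hv.continuous hvu hg, ← fourierCoeff_lift_eq hp']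
    rfl
  have := has_pointwise_sum_fourier_series_of_summable
    (f := (⟨hp'.lift, hc⟩ : C(AddCircle (1 : ℝ), ℂ))) (by rwa [funext hco])
    ((u t : ℝ) : AddCircle (1 : ℝ))
  simp only [hco, smul_eq_mul, ← wave_eq_fourier] at this
  simpa [hvu] using this

theorem warpCoeff_wave {u : ℝ → ℝ} (hu : IsWarp u) (j k : ℤ) :
    warpCoeff u (wave u j) k = if k = j then 1 else 0 := by
  obtain ⟨v, hv, huv, hvu, -⟩ := hu.exists_inverse
  have hp : Function.Periodic (fun x : ℝ => (fourier j (x : AddCircle (1 : ℝ)) : ℂ)) 1 := by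
    intro x
    simp
  rw [warpCoeff_eq_fourierCoeffOn hu hv.continuous hvu (hu.continuous_wave j)]
  simp only [wave_eq_fourier, huv]
  rw [← fourierCoeff_lift_eq hp]
  have : (hp.lift : AddCircle (1 : ℝ) → ℂ) = fourier j := by
    ext x
    induction x using QuotientAddGroup.induction_on
    rfl
  rw [this, fourierCoeff_fourier, Pi.single_apply]

theorem warpCoeff_intervalIntegrable {u : ℝ → ℝ} (hu : IsWarp u) {g : ℝ → ℂ} (hg : Continuous g)
    (k : ℤ) : IntervalIntegrable
      (fun t => g t * Complex.exp (-(2 * Real.pi * I * k * u t)) * (deriv u t : ℝ))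
      MeasureTheory.volume 0 1 := by
  have := hu.continuous
  have := hu.continuous_deriv
  exact Continuous.intervalIntegrable (by fun_prop) _ _

theorem warpCoeff_add {u : ℝ → ℝ} (hu : IsWarp u) {g h : ℝ → ℂ} (hg : Continuous g)
    (hh : Continuous h) (k : ℤ) :
    warpCoeff u (fun t => g t + h t) k = warpCoeff u g k + warpCoeff u h k := by
  unfold warpCoeff
  rw [← intervalIntegral.integral_add (warpCoeff_intervalIntegrable hu hg k)
    (warpCoeff_intervalIntegrable hu hh k)]
  simp only [add_mul]

theorem warpCoeff_const_mul (u : ℝ → ℝ) (c : ℂ) (g : ℝ → ℂ) (k : ℤ) :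
    warpCoeff u (fun t => c * g t) k = c * warpCoeff u g k := by
  unfold warpCoeff
  rw [← intervalIntegral.integral_const_mul]
  simp only [mul_assoc]

theorem warpCoeff_sum {u : ℝ → ℝ} (hu : IsWarp u) {ι : Type*} (s : Finset ι) {g : ι → ℝ → ℂ}
    (hg : ∀ i, Continuous (g i)) (k : ℤ) :
    warpCoeff u (fun t => ∑ i ∈ s, g i t) k = ∑ i ∈ s, warpCoeff u (g i) k := by
  unfold warpCoeff
  rw [← intervalIntegral.integral_finsetSum
    fun i _ => warpCoeff_intervalIntegrable hu (hg i) k]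
  simp only [Finset.sum_mul]

theorem warpCoeff_mul_wave {u : ℝ → ℝ} (g : ℝ → ℂ) (j k : ℤ) :
    warpCoeff u (fun t => g t * wave u j t) k = warpCoeff u g (k - j) := by
  simp only [warpCoeff_eq_integral_wave]
  refine intervalIntegral.integral_congr fun t _ => ?_
  have : -(k - j) = j + -k := by ring
  simp only [this, wave_add]
  ring

/-- The coefficients of a trigonometric polynomial in the coordinate `u`. -/
theorem warpCoeff_trigPoly {u : ℝ → ℝ} (hu : IsWarp u) (s : Finset ℤ) (d : ℤ → ℂ) (k : ℤ) :
    warpCoeff u (fun t => ∑ j ∈ s, d j * wave u j t) k = if k ∈ s then d k else 0 := by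
  rw [warpCoeff_sum hu s (g := fun j t => d j * wave u j t)
    fun j => continuous_const.mul (hu.continuous_wave j)]
  simp only [warpCoeff_const_mul, warpCoeff_wave hu]
  simp

/-- A function whose coefficients vanish off a finite set is a trigonometric polynomial. -/
theorem eq_sum_of_warpCoeff_eq_zero {u : ℝ → ℝ} (hu : IsWarp u) {g : ℝ → ℂ} (hg : Continuous g)
    (hp : Function.Periodic g 1) {s : Finset ℤ} (h0 : ∀ k ∉ s, warpCoeff u g k = 0) (t : ℝ) :
    g t = ∑ k ∈ s, warpCoeff u g k * wave u k t := by
  refine (hasSum_warpCoeff hu hg hp (summable_of_ne_finset_zero h0) t).unique ?_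
  exact hasSum_sum_of_ne_finset_zero fun k hk => by rw [h0 k hk, zero_mul]

/-- The measure `u' dt` has mass one on the unit interval, so the constant is one whatever `u` is.
-/
theorem norm_warpCoeff_le {u : ℝ → ℝ} (hu : IsWarp u) {g : ℝ → ℂ} {K : ℝ}
    (hK : ∀ t ∈ Set.Icc (0 : ℝ) 1, ‖g t‖ ≤ K) (k : ℤ) : ‖warpCoeff u g k‖ ≤ K := by
  rw [warpCoeff_eq_integral_wave]
  have h1 : (∫ t in (0 : ℝ)..1, K * deriv u t) = K := by
    rw [intervalIntegral.integral_const_mul, intervalIntegral.integral_deriv_eq_sub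
      (fun x _ => hu.differentiable x) (hu.continuous_deriv.intervalIntegrable _ _), hu.map_one,
      hu.map_zero]
    ring
  refine (intervalIntegral.norm_integral_le_of_norm_le zero_le_one ?_
    ((hu.continuous_deriv.const_mul K).intervalIntegrable _ _)).trans h1.le
  refine Filter.Eventually.of_forall fun t ht => ?_
  rw [norm_mul, norm_mul, norm_wave, mul_one, Complex.norm_real, Real.norm_of_nonneg
    (hu.deriv_pos t).le]
  exact mul_le_mul_of_nonneg_right (hK t ⟨ht.1.le, ht.2⟩) (hu.deriv_pos t).le

/-! ### Tails of Fourier series of `C¹` functions -/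

theorem sum_sq_fourierCoeffOn_le {g : ℝ → ℂ} (hg : Continuous g) {K : ℝ}
    (hK : ∀ x ∈ Set.Icc (0 : ℝ) 1, ‖g x‖ ≤ K) (s : Finset ℤ) :
    ∑ k ∈ s, ‖fourierCoeffOn (zero_lt_one : (0 : ℝ) < 1) g k‖ ^ 2 ≤ K ^ 2 := by
  have hL : MeasureTheory.MemLp g 2 (MeasureTheory.volume.restrict (Set.Ioc (0 : ℝ) 1)) := by
    refine MeasureTheory.MemLp.of_bound hg.aestronglyMeasurable K ?_
    rw [MeasureTheory.ae_restrict_iff' measurableSet_Ioc]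
    exact Filter.Eventually.of_forall fun x hx => hK x ⟨hx.1.le, hx.2⟩
  have h := hasSum_sq_fourierCoeffOn (zero_lt_one : (0 : ℝ) < 1) hL
  refine (sum_le_hasSum s (fun _ _ => by positivity) h).trans ?_
  simp only [sub_zero, inv_one, one_smul]
  have h2 := intervalIntegral.integral_mono_on (a := (0 : ℝ)) (b := 1)
    (f := fun x => ‖g x‖ ^ 2) (g := fun _ => K ^ 2) (μ := MeasureTheory.volume) zero_le_one
    (Continuous.intervalIntegrable (by fun_prop) _ _) (by simp)
    fun x hx => pow_le_pow_left₀ (norm_nonneg _) (hK x hx) 2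
  simpa using h2

theorem norm_fourierCoeffOn_of_hasDerivAt {g g' : ℝ → ℂ} (hp : Function.Periodic g 1)
    (hg : ∀ x, HasDerivAt g (g' x) x) (hg' : Continuous g') {k : ℤ} (hk : k ≠ 0) :
    ‖fourierCoeffOn (zero_lt_one : (0 : ℝ) < 1) g k‖
      = (2 * Real.pi * |(k : ℝ)|)⁻¹ * ‖fourierCoeffOn (zero_lt_one : (0 : ℝ) < 1) g' k‖ := by
  rw [fourierCoeffOn_of_hasDerivAt zero_lt_one hk (fun x _ => hg x)
    (hg'.intervalIntegrable _ _)]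
  have : g 1 = g 0 := by simpa using hp 0
  rw [this, sub_self, mul_zero, zero_sub]
  simp [abs_of_pos Real.pi_pos]

/-- A uniform bound for the tails of the Fourier series of a `C¹` function. -/
theorem exists_warpCoeff_tail_le {ε : ℝ} (hε : 0 < ε) : ∃ n₀ : ℕ,
    ∀ (u : ℝ → ℝ) (G G' : ℝ → ℂ) (K : ℝ), IsWarp u → Function.Periodic G 1 → 0 ≤ K →
      (∀ t, HasDerivAt G (G' t) t) → Continuous G' →
      (∀ t ∈ Set.Icc (0 : ℝ) 1, ‖G' t‖ ≤ K * deriv u t) →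
      ∀ s : Finset ℤ, (∀ k ∈ s, (n₀ : ℤ) < |k|) → ∑ k ∈ s, ‖warpCoeff u G k‖ ≤ ε * K := by
  have hsum : Summable fun k : ℤ => ((2 * Real.pi * |(k : ℝ)|)⁻¹) ^ 2 := by
    have h : Summable fun k : ℤ => 1 / (k : ℝ) ^ 2 :=
      Real.summable_one_div_int_pow.2 one_lt_two
    refine (h.mul_left ((2 * Real.pi)⁻¹ ^ 2)).congr fun k => ?_
    simp only [mul_inv, mul_pow, inv_pow, sq_abs, one_div]
  obtain ⟨S, hS⟩ := summable_iff_vanishing_norm.1 hsum (ε ^ 2) (by positivity)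
  -- This sum bounds `|k|` for every `k ∈ S`, so frequencies beyond it avoid `S`. It comes from the
  -- series of `1/k²` alone and is thus uniform in `u` and `G`.
  refine ⟨∑ k ∈ S, k.natAbs, fun u G G' K hu hp hK hG hG' hbd s hs => ?_⟩
  obtain ⟨v, hv, huv, hvu, hvd⟩ := hu.exists_inverse
  have hGc : Continuous G := continuous_iff_continuousAt.2 fun t => (hG t).continuousAt
  have hdisj : Disjoint s S := by
    refine Finset.disjoint_left.2 fun k hk hkS => ?_
    have h1 := hs k hk
    rw [Int.abs_eq_natAbs] at h1
    have h2 : k.natAbs ≤ ∑ k ∈ S, k.natAbs :=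
      Finset.single_le_sum (f := fun k : ℤ => k.natAbs) (fun _ _ => Nat.zero_le _) hkS
    omega
  have hne : ∀ k ∈ s, k ≠ 0 := by
    rintro k hk rfl
    have := hs 0 hk
    simp only [abs_zero] at this
    omega
  -- In the coordinate `x = u t` the derivative of `G` is `G' / u'`, which is why the hypothesis
  -- compares `G'` with `K * deriv u`. Cauchy–Schwarz and Parseval then finish.
  set H' : ℝ → ℂ := fun x => ((deriv u (v x))⁻¹ : ℝ) • G' (v x) with hH'
  have hH : ∀ x, HasDerivAt (fun x => G (v x)) (H' x) x := fun x =>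
    HasDerivAt.scomp x (hG (v x)) (hvd x)
  have hH'c : Continuous H' :=
    ((hu.continuous_deriv.comp hv.continuous).inv₀ fun x => (hu.deriv_pos _).ne').smul
      (hG'.comp hv.continuous)
  have hH'K : ∀ x ∈ Set.Icc (0 : ℝ) 1, ‖H' x‖ ≤ K := by
    intro x hx
    have hx' : v x ∈ Set.Icc (0 : ℝ) 1 := by
      rw [← hv.map_zero, ← hv.map_one]
      exact ⟨hv.strictMono.monotone hx.1, hv.strictMono.monotone hx.2⟩
    have hpos := hu.deriv_pos (v x)
    rw [hH', norm_smul, Real.norm_of_nonneg (inv_pos.2 hpos).le, inv_mul_le_iff₀ hpos, mul_comm]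
    exact hbd _ hx'
  have hp' : Function.Periodic (fun x => G (v x)) 1 := fun x => by
    simp only [hv.map_add_one, hp (v x)]
  calc ∑ k ∈ s, ‖warpCoeff u G k‖
      = ∑ k ∈ s, (2 * Real.pi * |(k : ℝ)|)⁻¹
          * ‖fourierCoeffOn (zero_lt_one : (0 : ℝ) < 1) H' k‖ := by
        refine Finset.sum_congr rfl fun k hk => ?_
        rw [warpCoeff_eq_fourierCoeffOn hu hv.continuous hvu hGc,
          norm_fourierCoeffOn_of_hasDerivAt hp' hH hH'c (hne k hk)]
    _ ≤ √(∑ k ∈ s, ((2 * Real.pi * |(k : ℝ)|)⁻¹) ^ 2)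
          * √(∑ k ∈ s, ‖fourierCoeffOn (zero_lt_one : (0 : ℝ) < 1) H' k‖ ^ 2) :=
        Real.sum_mul_le_sqrt_mul_sqrt _ _ _
    _ ≤ √(ε ^ 2) * √(K ^ 2) := by
        gcongr
        · exact ((le_abs_self _).trans_lt (hS s hdisj)).le
        · exact sum_sq_fourierCoeffOn_le hH'c hH'K s
    _ = ε * K := by rw [Real.sqrt_sq hε.le, Real.sqrt_sq hK]

/-! ### Demodulation and cutoff -/

/-- If the tail of a series is bounded by `τ`, so is its distance to the partial sum. -/
theorem norm_hasSum_sub_sum_le {F : ℤ → ℂ} {z : ℂ} (hF : HasSum F z) (s : Finset ℤ) {τ : ℝ}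
    (hτ : ∀ t : Finset ℤ, Disjoint t s → ∑ k ∈ t, ‖F k‖ ≤ τ) : ‖z - ∑ k ∈ s, F k‖ ≤ τ := by
  have hlim : Filter.Tendsto (fun t : Finset ℤ => ‖∑ k ∈ t, F k - ∑ k ∈ s, F k‖) Filter.atTop
      (nhds ‖z - ∑ k ∈ s, F k‖) := (Filter.Tendsto.sub_const hF _).norm
  refine le_of_tendsto hlim ?_
  filter_upwards [Filter.eventually_ge_atTop s] with t ht
  rw [← Finset.sum_sdiff ht, add_sub_cancel_right]
  exact (norm_sum_le _ _).trans (hτ _ Finset.sdiff_disjoint)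

/-- The coefficients of `g` with `N ≤ 2|k|` have `ℓ¹` norm at most `τ`. -/
def HighTail (u : ℝ → ℝ) (N : ℤ) (g : ℝ → ℂ) (τ : ℝ) : Prop :=
  ∀ s : Finset ℤ, (∀ k ∈ s, N ≤ 2 * |k|) → ∑ k ∈ s, ‖warpCoeff u g k‖ ≤ τ

/-- The indices on which the cutoff is one. -/
noncomputable def lowIndices (N : ℤ) : Finset ℤ := (Finset.Icc (-N) N).filter fun k => 2 * |k| < N

theorem mem_lowIndices {N k : ℤ} : k ∈ lowIndices N ↔ 2 * |k| < N := by
  rw [lowIndices, Finset.mem_filter, Finset.mem_Icc]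
  refine ⟨fun h => h.2, fun h => ⟨?_, h⟩⟩
  rcases abs_cases k with h' | h' <;> omega

theorem HighTail.summable {u : ℝ → ℝ} {N : ℤ} {g : ℝ → ℂ} {τ : ℝ} (h : HighTail u N g τ) :
    Summable (warpCoeff u g) := by
  refine Summable.of_norm ?_
  refine summable_of_sum_le (c := ∑ k ∈ lowIndices N, ‖warpCoeff u g k‖ + τ)
    (fun _ => norm_nonneg _) fun s => ?_
  rw [← Finset.sum_filter_add_sum_filter_not s (· ∈ lowIndices N)]
  refine add_le_add (Finset.sum_le_sum_of_subset_of_nonneg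
    (fun k hk => (Finset.mem_filter.1 hk).2) fun _ _ _ => norm_nonneg _) (h _ fun k hk => ?_)
  have := (Finset.mem_filter.1 hk).2
  rw [mem_lowIndices] at this
  omega

/-- Used for the aliasing terms: a shift by `±N` or `±2N` moves the whole low band into the range
controlled by the tail. -/
theorem HighTail.sum_image_le {u : ℝ → ℝ} {N : ℤ} {g : ℝ → ℂ} {τ : ℝ} (h : HighTail u N g τ)
    (l : ℤ) (hl : ∀ k ∈ lowIndices N, N ≤ 2 * |k + l|) :
    ∑ k ∈ lowIndices N, ‖warpCoeff u g (k + l)‖ ≤ τ := by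
  have := h ((lowIndices N).map (addRightEmbedding l)) (by simpa using hl)
  simpa using this

theorem cutoff_div_intCast {N : ℤ} (hN : 0 < N) (k : ℤ) :
    cutoff ((k : ℝ) / (N : ℝ)) = if k ∈ lowIndices N then 1 else 0 := by
  have hN' : (0 : ℝ) < N := by exact_mod_cast hN
  unfold cutoff
  congr 1
  rw [mem_lowIndices, eq_iff_iff, ← abs_lt, abs_div, abs_of_pos hN', div_lt_div_iff₀ hN' two_pos,
    one_mul, mul_comm, ← Int.cast_abs]
  exact_mod_cast Iff.rfl

/-- Demodulation at the frequency `N` followed by the cutoff recovers the envelopes up to the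
high-frequency tails. -/
theorem norm_demodulation_sub_le {u : ℝ → ℝ} (hu : IsWarp u) {N : ℤ} (hN : 0 < N)
    {f f₀ Z₁ Z₂ : ℝ → ℂ} (hf₀ : Continuous f₀)
    (hZ₁ : Continuous Z₁) (hp₁ : Function.Periodic Z₁ 1)
    (hZ₂ : Continuous Z₂) (hp₂ : Function.Periodic Z₂ 1)
    (hf : ∀ t, f t = f₀ t + (1 / 2 : ℂ) * (Z₁ t * wave u N t)
      + (1 / 2 : ℂ) * (Z₂ t * wave u (-N) t))
    {τ : ℝ} (h₀ : HighTail u N f₀ τ) (h₁ : HighTail u N Z₁ τ) (h₂ : HighTail u N Z₂ τ)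
    {c σ : ℂ} (hc : ‖c‖ = 1) (hσ : ‖σ‖ = 1) (t : ℝ) :
    ‖(∑' k : ℤ, c * (warpCoeff u f (k + N) + σ * warpCoeff u f (k - N))
        * cutoff ((k : ℝ) / (N : ℝ)) * wave u k t) - c * (Z₁ t + σ * Z₂ t) / 2‖ ≤ 4 * τ := by
  have hcoef : ∀ k, warpCoeff u f k = warpCoeff u f₀ k + (1 / 2 : ℂ) * warpCoeff u Z₁ (k - N)
      + (1 / 2 : ℂ) * warpCoeff u Z₂ (k + N) := by
    intro k
    have c1 : Continuous fun t => (1 / 2 : ℂ) * (Z₁ t * wave u N t) :=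
      continuous_const.mul (hZ₁.mul (hu.continuous_wave N))
    have c2 : Continuous fun t => (1 / 2 : ℂ) * (Z₂ t * wave u (-N) t) :=
      continuous_const.mul (hZ₂.mul (hu.continuous_wave (-N)))
    have c3 : Continuous fun t => f₀ t + (1 / 2 : ℂ) * (Z₁ t * wave u N t) := hf₀.add c1
    rw [funext hf, warpCoeff_add hu c3 c2, warpCoeff_add hu hf₀ c1,
      warpCoeff_const_mul, warpCoeff_const_mul, warpCoeff_mul_wave, warpCoeff_mul_wave, sub_neg_eq_add]
  set S := lowIndices N with hS
  have htsum : (∑' k : ℤ, c * (warpCoeff u f (k + N) + σ * warpCoeff u f (k - N))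
        * cutoff ((k : ℝ) / (N : ℝ)) * wave u k t)
      = ∑ k ∈ S, c * (warpCoeff u f (k + N) + σ * warpCoeff u f (k - N)) * wave u k t := by
    rw [tsum_eq_sum (s := S)]
    · refine Finset.sum_congr rfl fun k hk => ?_
      rw [cutoff_div_intCast hN, if_pos hk, mul_one]
    · intro k hk
      rw [cutoff_div_intCast hN, if_neg hk, mul_zero, zero_mul]
  -- `F` is the wanted part. `E` is the aliasing: `f₀` displaced by `±N`, and the opposite sideband
  -- displaced by `±2N`. Cutting off `F` costs `τ`. In `E`, the `f₀` terms cost `2τ` and the halved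
  -- sidebands cost `τ`, which gives `4τ` in total.
  set F : ℤ → ℂ := fun k => c * (warpCoeff u Z₁ k + σ * warpCoeff u Z₂ k) / 2 * wave u k t with hF
  set E : ℤ → ℂ := fun k => c * ((warpCoeff u f₀ (k + N) + σ * warpCoeff u f₀ (k + -N))
    + (warpCoeff u Z₂ (k + 2 * N) + σ * warpCoeff u Z₁ (k + -(2 * N))) / 2) * wave u k t with hE
  have hsplit : ∀ k, c * (warpCoeff u f (k + N) + σ * warpCoeff u f (k - N)) * wave u k t
      = F k + E k := by
    intro k
    have e1 : k + N - N = k := by ring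
    have e2 : k + N + N = k + 2 * N := by ring
    have e3 : k - N - N = k + -(2 * N) := by ring
    have e4 : k - N + N = k := by ring
    rw [hcoef, hcoef, hF, hE, e1, e2, e3, e4, sub_eq_add_neg]
    ring
  have hFsum : HasSum F (c * (Z₁ t + σ * Z₂ t) / 2) := by
    have s1 := hasSum_warpCoeff hu hZ₁ hp₁ h₁.summable t
    have s2 := hasSum_warpCoeff hu hZ₂ hp₂ h₂.summable t
    have s3 := (s1.add (s2.mul_left σ)).mul_left (c / 2)
    rw [show c * (Z₁ t + σ * Z₂ t) / 2 = c / 2 * (Z₁ t + σ * Z₂ t) by ring]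
    refine (funext fun k => ?_ : F = _) ▸ s3
    simp only [hF]
    ring
  have hFle : ∀ s : Finset ℤ, Disjoint s S → ∑ k ∈ s, ‖F k‖ ≤ τ := by
    intro s hs
    have hk : ∀ k ∈ s, N ≤ 2 * |k| := fun k hk => by
      have := Finset.disjoint_left.1 hs hk
      rw [hS, mem_lowIndices] at this
      omega
    have hle : ∀ k, ‖F k‖ ≤ (‖warpCoeff u Z₁ k‖ + ‖warpCoeff u Z₂ k‖) / 2 := by
      intro k
      simp only [hF, norm_mul, norm_div, norm_wave, hc, one_mul, mul_one, Complex.norm_ofNat]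
      gcongr
      exact (norm_add_le _ _).trans (by rw [norm_mul, hσ, one_mul])
    refine (Finset.sum_le_sum fun k _ => hle k).trans ?_
    rw [← Finset.sum_div, Finset.sum_add_distrib]
    linarith [h₁ s hk, h₂ s hk]
  have hEle : ‖∑ k ∈ S, E k‖ ≤ 3 * τ := by
    have hle : ∀ k, ‖E k‖ ≤ (‖warpCoeff u f₀ (k + N)‖ + ‖warpCoeff u f₀ (k + -N)‖)
        + (‖warpCoeff u Z₂ (k + 2 * N)‖ + ‖warpCoeff u Z₁ (k + -(2 * N))‖) / 2 := by
      intro k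
      simp only [hE, norm_mul, norm_wave, hc, one_mul, mul_one]
      refine (norm_add_le _ _).trans (add_le_add ?_ ?_)
      · exact (norm_add_le _ _).trans (by rw [norm_mul, hσ, one_mul])
      · rw [norm_div, Complex.norm_ofNat]
        gcongr
        exact (norm_add_le _ _).trans (by rw [norm_mul, hσ, one_mul])
    refine (norm_sum_le _ _).trans ((Finset.sum_le_sum fun k _ => hle k).trans ?_)
    rw [Finset.sum_add_distrib, Finset.sum_add_distrib, ← Finset.sum_div, Finset.sum_add_distrib]
    have hmem : ∀ k ∈ S, 2 * |k| < N := fun k hk => mem_lowIndices.1 hk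
    have b1 := h₀.sum_image_le N fun k hk => by
      have := hmem k hk
      rcases abs_cases k with h | h <;> rcases abs_cases (k + N) with h' | h' <;> omega
    have b2 := h₀.sum_image_le (-N) fun k hk => by
      have := hmem k hk
      rcases abs_cases k with h | h <;> rcases abs_cases (k + -N) with h' | h' <;> omega
    have b3 := h₂.sum_image_le (2 * N) fun k hk => by
      have := hmem k hk
      rcases abs_cases k with h | h <;> rcases abs_cases (k + 2 * N) with h' | h' <;> omega
    have b4 := h₁.sum_image_le (-(2 * N)) fun k hk => by
      have := hmem k hk
      rcases abs_cases k with h | h <;> rcases abs_cases (k + -(2 * N)) with h' | h' <;> omega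
    rw [← hS] at b1 b2 b3 b4
    linarith
  rw [htsum, Finset.sum_congr rfl fun k _ => hsplit k, Finset.sum_add_distrib]
  have := norm_hasSum_sub_sum_le hFsum S hFle
  calc _ = ‖(∑ k ∈ S, E k) - (c * (Z₁ t + σ * Z₂ t) / 2 - ∑ k ∈ S, F k)‖ := by congr 1; ring
    _ ≤ 3 * τ + τ := (norm_sub_le _ _).trans (add_le_add hEle this)
    _ = 4 * τ := by ring

/-! ### Trigonometric polynomials and the projection onto `V_M` -/

theorem mem_trigSpan_iff {M : ℕ} {F : ℝ → ℂ} : F ∈ trigSpan M ↔ ∃ d : ℤ → ℂ,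
    ∀ t, F t = ∑ k ∈ Finset.Icc (-(M : ℤ)) M, d k * wave (fun t => t) k t := by
  constructor
  · intro h
    induction h using Submodule.span_induction with
    | mem x hx =>
      obtain ⟨k, hk, rfl⟩ := hx
      refine ⟨fun j => if j = k then 1 else 0, fun t => ?_⟩
      simp [wave, abs_le.1 hk]
    | zero => exact ⟨0, fun t => by simp⟩
    | add x y _ _ hx hy =>
      obtain ⟨d, hd⟩ := hx
      obtain ⟨e, he⟩ := hy
      exact ⟨fun k => d k + e k, fun t => by
        simp [hd, he, add_mul, Finset.sum_add_distrib]⟩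
    | smul a x _ hx =>
      obtain ⟨d, hd⟩ := hx
      exact ⟨fun k => a * d k, fun t => by simp [hd, mul_assoc, Finset.mul_sum]⟩
  · rintro ⟨d, hd⟩
    have : F = ∑ k ∈ Finset.Icc (-(M : ℤ)) M, d k • wave (fun t => t) k := by
      funext t
      simp [hd]
    rw [this]
    refine Submodule.sum_mem _ fun k hk => Submodule.smul_mem _ _ (Submodule.subset_span ?_)
    exact ⟨k, abs_le.2 (Finset.mem_Icc.1 hk), rfl⟩

/-- A real trigonometric polynomial of degree at most `M`. -/
def IsRealTrig (M : ℕ) (g : ℝ → ℝ) : Prop := (fun t => (g t : ℂ)) ∈ trigSpan M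

/-- The `ℓ¹` norm of the Fourier coefficients of degree at most `M`. -/
noncomputable def lowL1 (M : ℕ) (g : ℝ → ℝ) : ℝ :=
  ∑ k ∈ Finset.Icc (-(M : ℤ)) M, ‖physCoeff g k‖

theorem lowL1_nonneg (M : ℕ) (g : ℝ → ℝ) : 0 ≤ lowL1 M g :=
  Finset.sum_nonneg fun _ _ => norm_nonneg _

namespace IsRealTrig

variable {M : ℕ} {g h : ℝ → ℝ}

theorem sub (hg : IsRealTrig M g) (hh : IsRealTrig M h) : IsRealTrig M (fun t => g t - h t) := by
  have := Submodule.sub_mem _ hg hh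
  unfold IsRealTrig
  convert this using 1
  funext t
  simp

theorem add (hg : IsRealTrig M g) (hh : IsRealTrig M h) : IsRealTrig M (fun t => g t + h t) := by
  have := Submodule.add_mem _ hg hh
  unfold IsRealTrig
  convert this using 1
  funext t
  simp

theorem div_const (hg : IsRealTrig M g) (c : ℝ) : IsRealTrig M (fun t => g t / c) := by
  have := Submodule.smul_mem _ ((c : ℂ)⁻¹) hg
  unfold IsRealTrig
  convert this using 1
  funext t
  simp [div_eq_inv_mul]

theorem continuous (hg : IsRealTrig M g) : Continuous g := by
  obtain ⟨d, hd⟩ := mem_trigSpan_iff.1 hg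
  have hc : Continuous fun t => (g t : ℂ) := by
    rw [show (fun t => (g t : ℂ)) = _ from funext hd]
    exact continuous_finsetSum _ fun k _ => continuous_const.mul (IsWarp.id.continuous_wave k)
  exact Complex.continuous_re.comp hc

theorem periodic (hg : IsRealTrig M g) : Function.Periodic g 1 := by
  obtain ⟨d, hd⟩ := mem_trigSpan_iff.1 hg
  intro t
  have : (g (t + 1) : ℂ) = g t := by
    rw [hd, hd]
    exact Finset.sum_congr rfl fun k _ => by rw [IsWarp.id.wave_periodic k t]
  exact_mod_cast this

theorem physCoeff_eq_zero (hg : IsRealTrig M g) {k : ℤ} (hk : k ∉ Finset.Icc (-(M : ℤ)) M) :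
    physCoeff g k = 0 := by
  obtain ⟨d, hd⟩ := mem_trigSpan_iff.1 hg
  rw [physCoeff_eq_warpCoeff, show (fun t => (g t : ℂ)) = _ from funext hd,
    warpCoeff_trigPoly IsWarp.id, if_neg hk]

theorem ofReal_eq_sum (hg : IsRealTrig M g) (t : ℝ) :
    (g t : ℂ) = ∑ k ∈ Finset.Icc (-(M : ℤ)) M, physCoeff g k * wave (fun t => t) k t := by
  simp only [physCoeff_eq_warpCoeff]
  refine eq_sum_of_warpCoeff_eq_zero (g := fun t => (g t : ℂ)) IsWarp.id
    (Complex.continuous_ofReal.comp hg.continuous) (fun t => by simp only [hg.periodic t])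
    (fun k hk => ?_) t
  rw [← physCoeff_eq_warpCoeff, hg.physCoeff_eq_zero hk]

theorem projV_eq (hg : IsRealTrig M g) (t : ℝ) : projV M g t = g t := by
  have := congrArg Complex.re (hg.ofReal_eq_sum t)
  rw [Complex.ofReal_re] at this
  exact this.symm

theorem fourierL1_eq (hg : IsRealTrig M g) : fourierL1 g = ENNReal.ofReal (lowL1 M g) := by
  rw [fourierL1, tsum_eq_sum (s := Finset.Icc (-(M : ℤ)) M)
    fun k hk => by rw [hg.physCoeff_eq_zero hk, enorm_zero], lowL1,
    ENNReal.ofReal_sum_of_nonneg fun _ _ => norm_nonneg _]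
  simp only [ofReal_norm]

theorem abs_le_lowL1 (hg : IsRealTrig M g) (t : ℝ) : |g t| ≤ lowL1 M g := by
  rw [← Real.norm_eq_abs, ← Complex.norm_real, hg.ofReal_eq_sum]
  refine (norm_sum_le _ _).trans (Finset.sum_le_sum fun k _ => ?_)
  rw [norm_mul, norm_wave, mul_one]

end IsRealTrig

theorem card_Icc_neg_natCast (M : ℕ) : (Finset.Icc (-(M : ℤ)) M).card = 2 * M + 1 := by
  rw [Int.card_Icc]
  omega

theorem lowL1_le {M : ℕ} {g : ℝ → ℝ} {K : ℝ} (hK : ∀ t, |g t| ≤ K) :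
    lowL1 M g ≤ (2 * M + 1) * K := by
  have h : ∀ k ∈ Finset.Icc (-(M : ℤ)) M, ‖physCoeff g k‖ ≤ K := fun k _ => by
    rw [physCoeff_eq_warpCoeff]
    exact norm_warpCoeff_le IsWarp.id (fun t _ => by simpa using hK t) k
  have := Finset.sum_le_card_nsmul _ _ _ h
  rw [card_Icc_neg_natCast, nsmul_eq_mul] at this
  exact_mod_cast this

theorem physCoeff_add {g h : ℝ → ℝ} (hg : Continuous g) (hh : Continuous h) (k : ℤ) :
    physCoeff (fun t => g t + h t) k = physCoeff g k + physCoeff h k := by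
  simp only [physCoeff_eq_warpCoeff, Complex.ofReal_add]
  exact warpCoeff_add IsWarp.id (Complex.continuous_ofReal.comp hg)
    (Complex.continuous_ofReal.comp hh) k

theorem projV_add (M : ℕ) {g h : ℝ → ℝ} (hg : Continuous g) (hh : Continuous h) (t : ℝ) :
    projV M (fun t => g t + h t) t = projV M g t + projV M h t := by
  simp only [projV, physCoeff_add hg hh, add_mul, Finset.sum_add_distrib, Complex.add_re]

theorem conj_wave (u : ℝ → ℝ) (k : ℤ) (t : ℝ) :
    (starRingEnd ℂ) (wave u k t) = wave u (-k) t := by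
  rw [wave_eq_exp_ofReal_mul_I, wave_eq_exp_ofReal_mul_I, ← Complex.exp_conj, map_mul,
    Complex.conj_ofReal, Complex.conj_I]
  simp

/-- Taking the real part symmetrizes the coefficients under `k ↦ -k` with conjugation. The
frequencies stay in the same symmetric range, so the real part remains in `V_M`. -/
theorem ofReal_projV_eq (M : ℕ) (g : ℝ → ℝ) (t : ℝ) :
    (projV M g t : ℂ) = ∑ k ∈ Finset.Icc (-(M : ℤ)) M,
      ((physCoeff g k + (starRingEnd ℂ) (physCoeff g (-k))) / 2) * wave (fun t => t) k t := by
  have h1 : projV M g t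
      = (∑ k ∈ Finset.Icc (-(M : ℤ)) M, physCoeff g k * wave (fun t => t) k t).re := rfl
  have h2 : ∑ k ∈ Finset.Icc (-(M : ℤ)) M, (starRingEnd ℂ) (physCoeff g (-k)) * wave (fun t => t) k t
      = ∑ k ∈ Finset.Icc (-(M : ℤ)) M,
        (starRingEnd ℂ) (physCoeff g k * wave (fun t => t) k t) := by
    refine Finset.sum_nbij' (fun k => -k) (fun k => -k) ?_ ?_ (by simp) (by simp) ?_
    · intro k hk; rw [Finset.mem_Icc] at *; omega
    · intro k hk; rw [Finset.mem_Icc] at *; omega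
    · intro k _; rw [map_mul, conj_wave, neg_neg]
  simp only [add_div, add_mul, div_mul_eq_mul_div]
  rw [Finset.sum_add_distrib, ← Finset.sum_div, ← Finset.sum_div, h2, h1, ← map_sum,
    Complex.re_eq_add_conj, add_div]

theorem isRealTrig_projV (M : ℕ) (g : ℝ → ℝ) : IsRealTrig M (projV M g) :=
  mem_trigSpan_iff.2 ⟨_, ofReal_projV_eq M g⟩

/-- Applied to the error of the frequency update: mean zero is what makes the next number of periods
exactly that of `θ`. -/
theorem integral_projV_eq_zero {M : ℕ} {g : ℝ → ℝ} (hg : physCoeff g 0 = 0) :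
    ∫ t in (0 : ℝ)..1, projV M g t = 0 := by
  have h1 : physCoeff (projV M g) 0 = 0 := by
    rw [physCoeff_eq_warpCoeff,
      show (fun t => (projV M g t : ℂ)) = _ from funext (ofReal_projV_eq M g),
      warpCoeff_trigPoly IsWarp.id]
    simp [hg]
  have h2 : physCoeff (projV M g) 0 = ((∫ t in (0 : ℝ)..1, projV M g t : ℝ) : ℂ) := by
    rw [physCoeff, fourierCoeffOn_zero_one_eq, ← intervalIntegral.integral_ofReal]
    simp
  rw [h1] at h2
  exact_mod_cast h2.symm

theorem abs_projV_le {M : ℕ} {g : ℝ → ℝ} {K : ℝ} (hK : ∀ k : ℤ, ‖physCoeff g k‖ ≤ |(k : ℝ)| * K)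
    (h0 : 0 ≤ K) (t : ℝ) : |projV M g t| ≤ (2 * M + 1) * (M * K) := by
  have h : ∀ k ∈ Finset.Icc (-(M : ℤ)) M, ‖physCoeff g k * wave (fun t => t) k t‖ ≤ M * K := by
    intro k hk
    rw [norm_mul, norm_wave, mul_one]
    refine (hK k).trans (mul_le_mul_of_nonneg_right ?_ h0)
    exact_mod_cast abs_le.2 (Finset.mem_Icc.1 hk)
  have h2 := (norm_sum_le (Finset.Icc (-(M : ℤ)) M)
    fun k => physCoeff g k * wave (fun t => t) k t).trans (Finset.sum_le_card_nsmul _ _ _ h)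
  rw [card_Icc_neg_natCast, nsmul_eq_mul] at h2
  refine (Complex.abs_re_le_norm _).trans (h2.trans (le_of_eq ?_))
  push_cast
  ring

/-! ### Phase functions and their normalizations -/

/-- A phase function whose instantaneous frequency is positive and lies in `V_M`. -/
structure IsPhase (M : ℕ) (φ : ℝ → ℝ) : Prop where
  differentiable : Differentiable ℝ φ
  isRealTrig : IsRealTrig M (deriv φ)
  deriv_pos : ∀ t, 0 < deriv φ t

namespace IsPhase

variable {M : ℕ} {φ : ℝ → ℝ}

theorem numPeriods_pos (hφ : IsPhase M φ) : 0 < numPeriods φ :=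
  div_pos (sub_pos.2 (strictMono_of_deriv_pos hφ.deriv_pos zero_lt_one)) Real.two_pi_pos

theorem hasDerivAt_normPhase (hφ : IsPhase M φ) (t : ℝ) :
    HasDerivAt (normPhase φ) (deriv φ t / (2 * Real.pi * numPeriods φ)) t :=
  ((hφ.differentiable t).hasDerivAt.sub_const _).div_const _

theorem deriv_normPhase (hφ : IsPhase M φ) :
    deriv (normPhase φ) = fun t => deriv φ t / (2 * Real.pi * numPeriods φ) :=
  funext fun t => (hφ.hasDerivAt_normPhase t).deriv

theorem eq_normPhase (hφ : IsPhase M φ) (t : ℝ) :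
    φ t = φ 0 + 2 * Real.pi * numPeriods φ * normPhase φ t := by
  have := hφ.numPeriods_pos
  have := Real.pi_pos
  unfold normPhase
  field_simp
  ring

theorem map_add_one (hφ : IsPhase M φ) (t : ℝ) :
    φ (t + 1) = φ t + 2 * Real.pi * numPeriods φ := by
  have hd : ∀ x, HasDerivAt (fun x => φ (x + 1) - φ x) (deriv φ (x + 1) - deriv φ x) x := fun x =>
    ((hφ.differentiable (x + 1)).hasDerivAt.comp_add_const x 1).sub
      (hφ.differentiable x).hasDerivAt
  have h := is_const_of_deriv_eq_zero (fun x => (hd x).differentiableAt)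
    (fun x => by rw [(hd x).deriv, hφ.isRealTrig.periodic x, sub_self]) t 0
  simp only [zero_add] at h
  have := Real.pi_pos
  have h2 : 2 * Real.pi * numPeriods φ = φ 1 - φ 0 := by
    unfold numPeriods; field_simp
  linarith

theorem isWarp (hφ : IsPhase M φ) : IsWarp (normPhase φ) where
  differentiable t := (hφ.hasDerivAt_normPhase t).differentiableAt
  continuous_deriv := by
    rw [hφ.deriv_normPhase]
    exact hφ.isRealTrig.continuous.div_const _
  deriv_pos t := by
    rw [hφ.deriv_normPhase]
    exact div_pos (hφ.deriv_pos t) (mul_pos Real.two_pi_pos hφ.numPeriods_pos)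
  map_zero := by simp [normPhase]
  map_add_one t := by
    have := hφ.numPeriods_pos
    have := Real.pi_pos
    unfold normPhase
    rw [hφ.map_add_one]
    field_simp
    ring

/-- The derivative is positive with integral one over a period, so each of its at most `2M + 1`
nonzero coefficients has modulus at most one. The bound depends on `M` only, not on the number of
periods. -/
theorem deriv_normPhase_le (hφ : IsPhase M φ) (t : ℝ) : deriv (normPhase φ) t ≤ 2 * M + 1 := by
  have htrig : IsRealTrig M (deriv (normPhase φ)) := by
    rw [hφ.deriv_normPhase]
    exact hφ.isRealTrig.div_const _
  refine (le_abs_self _).trans ((htrig.abs_le_lowL1 t).trans ?_)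
  have hu := hφ.isWarp
  have h : ∀ k ∈ Finset.Icc (-(M : ℤ)) M, ‖physCoeff (deriv (normPhase φ)) k‖ ≤ 1 := by
    intro k _
    rw [physCoeff_eq_warpCoeff, warpCoeff_eq_integral_wave]
    have h1 : (∫ t in (0 : ℝ)..1, deriv (normPhase φ) t) = 1 := by
      rw [intervalIntegral.integral_deriv_eq_sub (fun x _ => hu.differentiable x)
        (hu.continuous_deriv.intervalIntegrable _ _), hu.map_one, hu.map_zero, sub_zero]
    refine (intervalIntegral.norm_integral_le_of_norm_le zero_le_one
      (Filter.Eventually.of_forall fun t ht => ?_)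
      (hu.continuous_deriv.intervalIntegrable _ _)).trans h1.le
    rw [norm_mul, norm_mul, norm_wave, mul_one, Complex.norm_real,
      Real.norm_of_nonneg (hu.deriv_pos t).le]
    simp
  have := Finset.sum_le_card_nsmul _ _ _ h
  rw [card_Icc_neg_natCast, nsmul_eq_mul, mul_one] at this
  exact_mod_cast this

theorem integral_deriv (hφ : IsPhase M φ) :
    ∫ t in (0 : ℝ)..1, deriv φ t = 2 * Real.pi * numPeriods φ := by
  rw [intervalIntegral.integral_deriv_eq_sub (fun x _ => hφ.differentiable x)
    (hφ.isRealTrig.continuous.intervalIntegrable _ _)]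
  have := hφ.map_add_one 0
  rw [zero_add] at this
  linarith

end IsPhase

/-- Close instantaneous frequencies give close numbers of periods. -/
theorem abs_numPeriods_sub_le {M : ℕ} {θ φ : ℝ → ℝ} (hθ : IsPhase M θ) (hφ : IsPhase M φ) {δ : ℝ}
    (hδ : ∀ t, |deriv θ t - deriv φ t| ≤ δ) :
    2 * Real.pi * |numPeriods φ - numPeriods θ| ≤ δ := by
  have h1 := intervalIntegral.norm_integral_le_of_norm_le_const (a := 0) (b := 1)
    (f := fun t => deriv θ t - deriv φ t) (C := δ) fun t _ => hδ t
  rw [intervalIntegral.integral_sub (hθ.isRealTrig.continuous.intervalIntegrable _ _)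
    (hφ.isRealTrig.continuous.intervalIntegrable _ _), hθ.integral_deriv, hφ.integral_deriv,
    ← mul_sub, norm_mul, Real.norm_of_nonneg Real.two_pi_pos.le, Real.norm_eq_abs, abs_sub_comm]
    at h1
  simpa using h1

/-- Close instantaneous frequencies give close normalized phases. -/
theorem abs_deriv_normPhase_sub_le {M : ℕ} {θ φ : ℝ → ℝ} (hθ : IsPhase M θ) (hφ : IsPhase M φ)
    {δ : ℝ} (hδ : ∀ t, |deriv θ t - deriv φ t| ≤ δ) (t : ℝ) :
    |deriv (normPhase θ) t - deriv (normPhase φ) t|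
      ≤ (2 * M + 2) * δ / (2 * Real.pi * numPeriods φ) := by
  have hL := hθ.numPeriods_pos
  have hN := hφ.numPeriods_pos
  have hpi := Real.pi_pos
  have h1 := abs_numPeriods_sub_le hθ hφ hδ
  -- Over the common denominator `2π L_φ`, the discrepancy splits into a change in the number of
  -- periods, weighted by the bounded normalized frequency of `θ`, and a change of frequency. These
  -- give `(2M + 1) δ` and `δ`.
  have key : deriv (normPhase θ) t - deriv (normPhase φ) t
      = (deriv (normPhase θ) t * (2 * Real.pi * (numPeriods φ - numPeriods θ))
        + (deriv θ t - deriv φ t)) / (2 * Real.pi * numPeriods φ) := by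
    rw [hθ.deriv_normPhase, hφ.deriv_normPhase]
    field_simp
    ring
  rw [key, abs_div, abs_of_pos (show 0 < 2 * Real.pi * numPeriods φ by positivity)]
  gcongr
  refine (abs_add_le _ _).trans ?_
  rw [abs_mul, abs_mul, abs_of_pos (hθ.isWarp.deriv_pos t), abs_of_pos Real.two_pi_pos]
  have h2 : deriv (normPhase θ) t * (2 * Real.pi * |numPeriods φ - numPeriods θ|)
      ≤ (2 * M + 1) * δ :=
    mul_le_mul (hθ.deriv_normPhase_le t) h1 (by positivity) (by positivity)
  linarith [hδ t]

/-! ### High-frequency tails of modulated signals -/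

theorem norm_exp_ofReal_mul_I_sub_le (x y : ℝ) :
    ‖Complex.exp (x * I) - Complex.exp (y * I)‖ ≤ |x - y| := by
  have h : Complex.exp (x * I) - Complex.exp (y * I)
      = Complex.exp (y * I) * (Complex.exp (I * ((x - y : ℝ) : ℂ)) - 1) := by
    rw [mul_sub, ← Complex.exp_add, mul_one]
    congr 2
    push_cast
    ring
  rw [h, norm_mul, Complex.norm_exp_ofReal_mul_I, one_mul]
  exact Real.norm_exp_I_mul_ofReal_sub_one_le

/-- The derivative of the difference of two exponentials with close phases is small. -/
theorem norm_exp_mul_deriv_sub_le (x y x' y' : ℝ) :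
    ‖Complex.exp (x * I) * (x' * I) - Complex.exp (y * I) * (y' * I)‖
      ≤ |x' - y'| + |x - y| * |y'| := by
  have h : Complex.exp (x * I) * (x' * I) - Complex.exp (y * I) * (y' * I)
      = Complex.exp (x * I) * (((x' - y' : ℝ) : ℂ) * I)
        + (Complex.exp (x * I) - Complex.exp (y * I)) * (y' * I) := by
    push_cast
    ring
  rw [h]
  refine (norm_add_le _ _).trans (add_le_add ?_ ?_)
  · rw [norm_mul, norm_mul, Complex.norm_exp_ofReal_mul_I, Complex.norm_real, Complex.norm_I,
      one_mul, mul_one, Real.norm_eq_abs]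
  · rw [norm_mul, norm_mul, Complex.norm_real, Complex.norm_I, mul_one, Real.norm_eq_abs]
    exact mul_le_mul_of_nonneg_right (norm_exp_ofReal_mul_I_sub_le x y) (abs_nonneg _)

theorem hasDerivAt_exp_ofReal_mul_I {α : ℝ → ℝ} {α' t : ℝ} (h : HasDerivAt α α' t) :
    HasDerivAt (fun t => Complex.exp (α t * I)) (Complex.exp (α t * I) * (α' * I)) t :=
  (h.ofReal_comp.mul_const I).cexp

theorem abs_sub_le_of_abs_deriv_le {γ γ' : ℝ → ℝ} {η : ℝ} (hγ : ∀ t, HasDerivAt γ (γ' t) t)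
    (hη : ∀ t, |γ' t| ≤ η) {t : ℝ} (ht : t ∈ Set.Icc (0 : ℝ) 1) : |γ t - γ 0| ≤ η := by
  have h := norm_image_sub_le_of_norm_deriv_le_segment' (a := 0) (b := 1) (f := γ) (f' := γ')
    (C := η) (fun x _ => (hγ x).hasDerivWithinAt) (fun x _ => hη x) t ht
  have h0 : 0 ≤ η := (abs_nonneg _).trans (hη 0)
  rw [Real.norm_eq_abs, sub_zero] at h
  exact h.trans (mul_le_of_le_one_right h0 ht.2)

/-- The high-frequency tail, in the coordinate `u`, of a modulated trigonometric polynomial in a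
nearby coordinate `w` is controlled by the distance of the coordinates and by the modulation
frequency. -/
theorem exists_highTail_modulated (M₁ : ℕ) {c : ℝ} (hc : 0 < c) (C : ℝ) {ε : ℝ} (hε : 0 < ε) :
    ∃ n : ℕ, ∀ (N : ℤ) (u w ψ ψ' : ℝ → ℝ) (d : ℤ → ℂ) (G : ℝ → ℂ) (δ : ℝ),
      (n : ℤ) ≤ N → IsWarp u → IsWarp w → (∀ t, HasDerivAt ψ (ψ' t) t) → Continuous ψ' →
      (∀ k, ‖d k‖ ≤ C) → Function.Periodic G 1 →
      (∀ t, G t = ∑ j ∈ Finset.Icc (-(M₁ : ℤ)) M₁, d j * wave w j t * Complex.exp (ψ t * I)) →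
      (∀ t, c ≤ deriv u t) → (∀ t, 2 * Real.pi * |deriv w t - deriv u t| ≤ δ) →
      (∀ t, |ψ' t| ≤ δ) → HighTail u N G (ε * δ) := by
  -- `P δ u'` will bound the derivative of the remainder: `2M₁ + 1` terms with coefficients at most
  -- `|C|`, each paying for a phase-derivative error (with `1 ≤ c⁻¹ u'`) and for a phase error times
  -- `2π M₁ u'`. The final `1` keeps `P` positive.
  set P : ℝ := (2 * M₁ + 1) * |C| * ((M₁ + 1) * c⁻¹ + (M₁ + 1) * (2 * Real.pi * M₁)) + 1 with hP
  have hPpos : 0 < P := by positivity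
  obtain ⟨n₀, hn₀⟩ := exists_warpCoeff_tail_le (div_pos hε hPpos)
  -- With this threshold, `N ≤ 2|k|` forces both `|k| > M₁`, where the comparison polynomial has no
  -- coefficient, and `|k| > n₀`.
  refine ⟨2 * n₀ + 2 * M₁ + 2, fun N u w ψ ψ' d G δ hN hu hw hψ hψ' hd hGp hG hcu hwu hψδ s hs => ?_⟩
  have hδ : 0 ≤ δ := (abs_nonneg _).trans (hψδ 0)
  set J := Finset.Icc (-(M₁ : ℤ)) M₁ with hJ
  have hJabs : ∀ j ∈ J, |(j : ℝ)| ≤ M₁ := fun j hj => by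
    exact_mod_cast abs_le.2 (Finset.mem_Icc.1 hj)
  set α : ℤ → ℝ → ℝ := fun j t => 2 * Real.pi * j * w t + ψ t with hα
  -- The modulation is frozen at `ψ 0`: each term becomes a multiple of a single exponential in `u`,
  -- and `α j - β j` vanishes at `0`, so its size follows from that of its derivative.
  set β : ℤ → ℝ → ℝ := fun j t => 2 * Real.pi * j * u t + ψ 0 with hβ
  set α' : ℤ → ℝ → ℝ := fun j t => 2 * Real.pi * j * deriv w t + ψ' t with hα'
  set β' : ℤ → ℝ → ℝ := fun j t => 2 * Real.pi * j * deriv u t with hβ'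
  have hαd : ∀ j t, HasDerivAt (α j) (α' j t) t := fun j t =>
    ((hw.differentiable t).hasDerivAt.const_mul _).add (hψ t)
  have hβd : ∀ j t, HasDerivAt (β j) (β' j t) t := fun j t =>
    ((hu.differentiable t).hasDerivAt.const_mul _).add_const _
  have hα'c : ∀ j, Continuous (α' j) := fun j => (hw.continuous_deriv.const_mul _).add hψ'
  have hβ'c : ∀ j, Continuous (β' j) := fun j => hu.continuous_deriv.const_mul _
  have hαc : ∀ j, Continuous (α j) := fun j =>
    continuous_iff_continuousAt.2 fun t => (hαd j t).continuousAt
  have hβc : ∀ j, Continuous (β j) := fun j =>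
    continuous_iff_continuousAt.2 fun t => (hβd j t).continuousAt
  set T : ℝ → ℂ := fun t => ∑ j ∈ J, (d j * Complex.exp (ψ 0 * I)) * wave u j t with hT
  set W : ℝ → ℂ := fun t => ∑ j ∈ J, d j * (Complex.exp (α j t * I) - Complex.exp (β j t * I))
    with hW
  set W' : ℝ → ℂ := fun t => ∑ j ∈ J, d j * (Complex.exp (α j t * I) * (α' j t * I)
    - Complex.exp (β j t * I) * (β' j t * I)) with hW'
  have hWd : ∀ t, HasDerivAt W (W' t) t := fun t => by
    refine HasDerivAt.fun_sum fun j _ => HasDerivAt.const_mul _ ?_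
    exact (hasDerivAt_exp_ofReal_mul_I (hαd j t)).sub (hasDerivAt_exp_ofReal_mul_I (hβd j t))
  have hW'c : Continuous W' := by
    refine continuous_finsetSum _ fun j _ => ?_
    have := hα'c j
    have := hβ'c j
    have := hαc j
    have := hβc j
    fun_prop
  have hTc : Continuous T :=
    continuous_finsetSum _ fun j _ => continuous_const.mul (hu.continuous_wave j)
  have hWc : Continuous W := continuous_iff_continuousAt.2 fun t => (hWd t).continuousAt
  have hGT : ∀ t, G t = W t + T t := by
    intro t
    rw [hG, hW, hT, ← Finset.sum_add_distrib]
    refine Finset.sum_congr rfl fun j _ => ?_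
    simp only [hα, hβ, wave_eq_exp_ofReal_mul_I, Complex.ofReal_add, add_mul, Complex.exp_add]
    ring
  have hTp : Function.Periodic T 1 := fun t =>
    Finset.sum_congr rfl fun j _ => by rw [hu.wave_periodic j t]
  have hWp : Function.Periodic W 1 := fun t => by
    have h1 := hGT t
    have h2 := hGT (t + 1)
    rw [hGp t, hTp t] at h2
    exact add_right_cancel (h2.symm.trans h1)
  have hη1 : ∀ j ∈ J, ∀ t, |α' j t - β' j t| ≤ (M₁ + 1) * δ := by
    intro j hj t
    have : α' j t - β' j t = j * (2 * Real.pi * (deriv w t - deriv u t)) + ψ' t := by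
      simp only [hα', hβ']; ring
    rw [this]
    refine (abs_add_le _ _).trans ?_
    rw [abs_mul, abs_mul (2 * Real.pi), abs_of_pos Real.two_pi_pos]
    have := mul_le_mul (hJabs j hj) (hwu t) (by positivity) (by positivity)
    linarith [hψδ t]
  have hη0 : ∀ j ∈ J, ∀ t ∈ Set.Icc (0 : ℝ) 1, |α j t - β j t| ≤ (M₁ + 1) * δ := by
    intro j hj t ht
    have := abs_sub_le_of_abs_deriv_le (γ := fun t => α j t - β j t)
      (fun t => (hαd j t).sub (hβd j t)) (hη1 j hj) ht
    simpa [hα, hβ, hu.map_zero, hw.map_zero] using this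
  have hW'bd : ∀ t ∈ Set.Icc (0 : ℝ) 1, ‖W' t‖ ≤ P * δ * deriv u t := by
    intro t ht
    have hupos := hu.deriv_pos t
    have hterm : ∀ j ∈ J, ‖d j * (Complex.exp (α j t * I) * (α' j t * I)
        - Complex.exp (β j t * I) * (β' j t * I))‖
        ≤ |C| * ((M₁ + 1) * δ * (c⁻¹ * deriv u t)
          + (M₁ + 1) * δ * (2 * Real.pi * M₁ * deriv u t)) := by
      intro j hj
      rw [norm_mul]
      refine mul_le_mul ((hd j).trans (le_abs_self C)) ?_ (norm_nonneg _) (abs_nonneg _)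
      refine (norm_exp_mul_deriv_sub_le _ _ _ _).trans (add_le_add ?_ ?_)
      · refine (hη1 j hj t).trans (le_mul_of_one_le_right (by positivity) ?_)
        rw [← div_eq_inv_mul, one_le_div hc]
        exact hcu t
      · refine mul_le_mul (hη0 j hj t ht) ?_ (abs_nonneg _) (by positivity)
        simp only [hβ']
        rw [abs_mul, abs_mul, abs_of_pos Real.two_pi_pos, abs_of_pos hupos]
        gcongr
        exact hJabs j hj
    have := (norm_sum_le J _).trans (Finset.sum_le_card_nsmul _ _ _ hterm)
    rw [hJ, card_Icc_neg_natCast, nsmul_eq_mul, ← hJ] at this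
    refine this.trans ?_
    rw [hP]
    have : 0 ≤ δ * deriv u t := by positivity
    push_cast
    linarith
  have hGW : ∀ k ∈ s, warpCoeff u G k = warpCoeff u W k := by
    intro k hk
    have hk' : k ∉ J := by
      have := hs k hk
      rw [hJ, Finset.mem_Icc, ← abs_le]
      omega
    rw [funext hGT, warpCoeff_add hu hWc hTc, hT, warpCoeff_trigPoly hu, if_neg hk', add_zero]
  rw [Finset.sum_congr rfl fun k hk => by rw [hGW k hk]]
  refine (hn₀ u W W' (P * δ) hu hWp (by positivity) hWd hW'c hW'bd s fun k hk => ?_).trans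
    (le_of_eq ?_)
  · have := hs k hk
    omega
  · field_simp

/-! ### Accuracy of the extracted envelopes -/

/-- A signal `f₀ + f₁ cos θ` whose components are sparse in the coordinate `θ̄`. -/
structure IsSignal (M₀ M₁ : ℕ) (c κ C : ℝ) (θ f₀ f₁ f : ℝ → ℝ) : Prop where
  isPhase : IsPhase M₀ θ
  exists_int : ∃ L : ℤ, numPeriods θ = L
  eq : ∀ t, f t = f₀ t + f₁ t * Real.cos (θ t)
  continuous₀ : Continuous f₀
  periodic₀ : Function.Periodic f₀ 1
  continuous₁ : Continuous f₁
  periodic₁ : Function.Periodic f₁ 1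
  sparse : ∀ k : ℤ, (M₁ : ℤ) < |k| → phaseCoeff θ f₀ k = 0 ∧ phaseCoeff θ f₁ k = 0
  le_deriv : ∀ t, c ≤ deriv (normPhase θ) t
  le_envelope : ∀ t, κ ≤ f₁ t
  bound : ∀ k : ℤ, ‖phaseCoeff θ f₀ k‖ ≤ C ∧ ‖phaseCoeff θ f₁ k‖ ≤ C

theorem phaseCoeff_intCast (θ g : ℝ → ℝ) (k : ℤ) :
    phaseCoeff θ g k = warpCoeff (normPhase θ) (fun t => (g t : ℂ)) k := by
  simp [phaseCoeff, warpCoeff]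

/-- The number of periods of the phase of a periodic oscillation is an integer. -/
theorem exists_numPeriods_eq_intCast {M : ℕ} {θ f₀ f₁ f : ℝ → ℝ} (hθ : IsPhase M θ)
    (hf : Function.Periodic f 1) (heq : ∀ t, f t = f₀ t + f₁ t * Real.cos (θ t))
    (hp₀ : Function.Periodic f₀ 1) (hp₁ : Function.Periodic f₁ 1) (hpos : ∀ t, 0 < f₁ t) :
    ∃ L : ℤ, numPeriods θ = L := by
  have hL := hθ.numPeriods_pos
  have hpi := Real.pi_pos
  -- At a point where `θ` vanishes, periodicity of `f` and positivity of `f₁` reduce to `cos (2πL) =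
  -- 1`.
  obtain ⟨t, ht⟩ := hθ.isWarp.surjective (-θ 0 / (2 * Real.pi * numPeriods θ))
  have hθt : θ t = 0 := by
    rw [hθ.eq_normPhase t, ht]
    field_simp
    ring
  have h := hf t
  rw [heq, heq, hp₀ t, hp₁ t, hθ.map_add_one, hθt, zero_add, Real.cos_zero] at h
  have h1 := mul_left_cancel₀ (hpos t).ne' (add_left_cancel h)
  obtain ⟨n, hn⟩ := (Real.cos_eq_one_iff _).1 h1
  refine ⟨n, ?_⟩
  have : (n : ℝ) * (2 * Real.pi) = numPeriods θ * (2 * Real.pi) := by linarith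
  exact (mul_right_cancel₀ (by positivity) this).symm

theorem ofReal_eq_sum_phaseCoeff {M M₁ : ℕ} {θ g : ℝ → ℝ} (hθ : IsPhase M θ) (hg : Continuous g)
    (hp : Function.Periodic g 1) (h0 : ∀ k : ℤ, (M₁ : ℤ) < |k| → phaseCoeff θ g k = 0) (t : ℝ) :
    (g t : ℂ) = ∑ j ∈ Finset.Icc (-(M₁ : ℤ)) M₁, phaseCoeff θ g j * wave (normPhase θ) j t := by
  simp only [phaseCoeff_intCast] at h0 ⊢
  refine eq_sum_of_warpCoeff_eq_zero (g := fun t => (g t : ℂ)) hθ.isWarp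
    (Complex.continuous_ofReal.comp hg) (fun t => by simp only [hp t]) (fun k hk => h0 k ?_) t
  rw [Finset.mem_Icc, ← abs_le] at hk
  omega

theorem envA_eq {φ f : ℝ → ℝ} {N : ℤ} (hN : numPeriods φ = N) (t : ℝ) :
    envA f φ t = (∑' k : ℤ, 1 * (warpCoeff (normPhase φ) (fun t => (f t : ℂ)) (k + N)
      + 1 * warpCoeff (normPhase φ) (fun t => (f t : ℂ)) (k - N))
      * cutoff ((k : ℝ) / (N : ℝ)) * wave (normPhase φ) k t).re := by
  simp only [envA, hN, one_mul, ← phaseCoeff_intCast, wave, Int.cast_add, Int.cast_sub]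

theorem envB_eq {φ f : ℝ → ℝ} {N : ℤ} (hN : numPeriods φ = N) (t : ℝ) :
    envB f φ t = (∑' k : ℤ, -I * (warpCoeff (normPhase φ) (fun t => (f t : ℂ)) (k + N)
      + -1 * warpCoeff (normPhase φ) (fun t => (f t : ℂ)) (k - N))
      * cutoff ((k : ℝ) / (N : ℝ)) * wave (normPhase φ) k t).re := by
  simp only [envB, hN, ← phaseCoeff_intCast, wave, Int.cast_add, Int.cast_neg, sub_eq_add_neg,
    neg_one_mul]

theorem abs_re_sub_le (z : ℂ) (x : ℝ) : |z.re - x| ≤ ‖z - x‖ := by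
  simpa using Complex.abs_re_le_norm (z - x)

/-- The phase error, normalized so that `f₁ cos θ` is the real part of
`f₁ e^{i · phaseError} e^{2πi L_φ φ̄}`. -/
def phaseError (θ φ : ℝ → ℝ) (t : ℝ) : ℝ := θ t - φ t + φ 0

/-- The extracted envelopes are close to the exact ones if the phases are close. -/
theorem exists_envelope_close (M₀ M₁ : ℕ) {c : ℝ} (hc : 0 < c) (κ C : ℝ) {ε : ℝ} (hε : 0 < ε) :
    ∃ η : ℝ, ∀ (θ f₀ f₁ f φ : ℝ → ℝ) (δ : ℝ), IsSignal M₀ M₁ c κ C θ f₀ f₁ f → IsPhase M₀ φ →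
      (∃ N : ℤ, numPeriods φ = N) → (∀ t, |deriv θ t - deriv φ t| ≤ δ) → δ ≤ Real.pi * M₀ / 2 →
      η ≤ numPeriods θ → ∀ t,
        |envA f φ t - f₁ t * Real.cos (phaseError θ φ t)| ≤ ε * δ ∧
        |envB f φ t - f₁ t * Real.sin (phaseError θ φ t)| ≤ ε * δ := by
  -- The tail bound is applied with `c / 2` for the frequency of `φ` and with `(2M₀ + 2) δ` as the
  -- error. The factor `4` offsets the `4τ` of the demodulation.
  obtain ⟨n, hn⟩ := exists_highTail_modulated M₁ (half_pos hc) C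
    (show 0 < ε / (4 * (2 * M₀ + 2)) by positivity)
  -- The term `M₀ / 4` pays for passing from the periods of `θ` to those of `φ`. The others ensure,
  -- in order, the tail threshold, a normalized frequency of `φ` at least `c / 2`, and at least one
  -- period.
  refine ⟨n + M₀ / 4 + (M₀ + 1) * M₀ / c + 1, ?_⟩
  rintro θ f₀ f₁ f φ δ hs hφ ⟨N, hN⟩ hδ hδM hη t
  have hpi := Real.pi_pos
  have hθ := hs.isPhase
  obtain ⟨L, hL⟩ := hs.exists_int
  have hδ0 : 0 ≤ δ := (abs_nonneg _).trans (hδ 0)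
  have hNpos := hφ.numPeriods_pos
  have hNL : |numPeriods φ - numPeriods θ| ≤ M₀ / 4 := by
    have := (abs_numPeriods_sub_le hθ hφ hδ).trans hδM
    rw [show Real.pi * M₀ / 2 = 2 * Real.pi * (M₀ / 4) by ring] at this
    exact le_of_mul_le_mul_left this (by positivity)
  have hNlow : n + (M₀ + 1) * M₀ / c + 1 ≤ numPeriods φ := by
    have := (abs_le.1 hNL).1
    linarith
  have hq : 0 ≤ (M₀ + 1) * M₀ / c := by positivity
  have hN1 : 1 ≤ numPeriods φ := by
    have : (0 : ℝ) ≤ n := n.cast_nonneg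
    linarith
  have hnN : (n : ℤ) ≤ N := by
    have : ((n : ℤ) : ℝ) ≤ N := by
      rw [← hN]
      push_cast
      linarith
    exact_mod_cast this
  have hN0 : 0 < N := by
    rw [hN] at hNpos
    exact_mod_cast hNpos
  have hdiff := abs_deriv_normPhase_sub_le hθ hφ hδ
  have hcu : ∀ t, c / 2 ≤ deriv (normPhase φ) t := by
    intro t
    have h1 : (2 * M₀ + 2) * δ / (2 * Real.pi * numPeriods φ) ≤ c / 2 := by
      rw [div_le_iff₀ (by positivity)]
      have h2 : (M₀ + 1) * M₀ ≤ c * numPeriods φ := by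
        rw [← div_le_iff₀' hc]
        have : (0 : ℝ) ≤ n := n.cast_nonneg
        linarith
      calc (2 * M₀ + 2) * δ ≤ (2 * M₀ + 2) * (Real.pi * M₀ / 2) := by gcongr
        _ = Real.pi * ((M₀ + 1) * M₀) := by ring
        _ ≤ Real.pi * (c * numPeriods φ) := by gcongr
        _ = c / 2 * (2 * Real.pi * numPeriods φ) := by ring
    have := (abs_le.1 ((hdiff t).trans h1)).2
    linarith [hs.le_deriv t]
  have hwu : ∀ t, 2 * Real.pi * |deriv (normPhase θ) t - deriv (normPhase φ) t|
      ≤ (2 * M₀ + 2) * δ := by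
    intro t
    refine (mul_le_mul_of_nonneg_left (hdiff t) Real.two_pi_pos.le).trans ?_
    rw [mul_div_assoc', mul_div_mul_left _ _ Real.two_pi_pos.ne']
    exact div_le_self (by positivity) hN1
  have hδle : δ ≤ (2 * M₀ + 2) * δ := le_mul_of_one_le_left hδ0 (by
    have : (0 : ℝ) ≤ M₀ := M₀.cast_nonneg
    linarith)
  have hε' : ε / (4 * (2 * M₀ + 2)) * ((2 * M₀ + 2) * δ) = ε * δ / 4 := by
    field_simp
  set ψ := phaseError θ φ with hψ
  have hψd : ∀ t, HasDerivAt ψ (deriv θ t - deriv φ t) t := fun t =>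
    ((hθ.differentiable t).hasDerivAt.sub (hφ.differentiable t).hasDerivAt).add_const _
  have hψ'c : Continuous fun t => deriv θ t - deriv φ t :=
    hθ.isRealTrig.continuous.sub hφ.isRealTrig.continuous
  have hψc : Continuous ψ := continuous_iff_continuousAt.2 fun t => (hψd t).continuousAt
  have hψper : ∀ t, ψ (t + 1) = ψ t + (L - N : ℤ) * (2 * Real.pi) := by
    intro t
    simp only [hψ, phaseError, hθ.map_add_one, hφ.map_add_one, hL, hN]
    push_cast
    ring
  have hexp1 : Function.Periodic (fun t => Complex.exp (ψ t * I)) 1 := by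
    intro t
    simp only [hψper]
    rw [← Complex.exp_periodic.int_mul (L - N) (ψ t * I)]
    congr 1
    push_cast
    ring
  have hexp2 : Function.Periodic (fun t => Complex.exp ((-ψ t : ℝ) * I)) 1 := by
    intro t
    simp only [hψper]
    rw [← Complex.exp_periodic.int_mul (-(L - N)) ((-ψ t : ℝ) * I)]
    congr 1
    push_cast
    ring
  have hrep₀ := ofReal_eq_sum_phaseCoeff hθ hs.continuous₀ hs.periodic₀ fun k hk => (hs.sparse k hk).1
  have hrep₁ := ofReal_eq_sum_phaseCoeff hθ hs.continuous₁ hs.periodic₁ fun k hk => (hs.sparse k hk).2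
  -- The unmodulated component is the case of zero phase error.
  have t₀ : HighTail (normPhase φ) N (fun t => (f₀ t : ℂ)) (ε * δ / 4) := by
    rw [← hε']
    refine hn N _ (normPhase θ) (fun _ => 0) (fun _ => 0) _ _ _ hnN hφ.isWarp hθ.isWarp
      (fun t => hasDerivAt_const t 0) continuous_const (fun k => (hs.bound k).1)
      (fun t => by simp only [hs.periodic₀ t]) (fun t => ?_) hcu hwu
      (fun t => by rw [abs_zero]; positivity)
    rw [hrep₀]
    simp
  have t₁ : HighTail (normPhase φ) N (fun t => f₁ t * Complex.exp (ψ t * I)) (ε * δ / 4) := by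
    rw [← hε']
    refine hn N _ (normPhase θ) ψ _ _ _ _ hnN hφ.isWarp hθ.isWarp hψd hψ'c
      (fun k => (hs.bound k).2) (fun t => ?_) (fun t => ?_) hcu hwu
      (fun t => (hδ t).trans hδle)
    · simp only [hs.periodic₁ t, hexp1 t]
    · rw [hrep₁, Finset.sum_mul]
  have t₂ : HighTail (normPhase φ) N (fun t => f₁ t * Complex.exp ((-ψ t : ℝ) * I))
      (ε * δ / 4) := by
    rw [← hε']
    refine hn N _ (normPhase θ) (fun t => -ψ t) (fun t => -(deriv θ t - deriv φ t)) _ _ _ hnN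
      hφ.isWarp hθ.isWarp (fun t => (hψd t).neg) hψ'c.neg
      (fun k => (hs.bound k).2) (fun t => ?_) (fun t => ?_) hcu hwu
      (fun t => by rw [abs_neg]; exact (hδ t).trans hδle)
    · simp only [hs.periodic₁ t, hexp2 t]
    · rw [hrep₁, Finset.sum_mul]
  have hcf : Continuous fun t => (f₁ t : ℂ) := Complex.continuous_ofReal.comp hs.continuous₁
  have hf : ∀ t, (f t : ℂ) = f₀ t
      + (1 / 2 : ℂ) * (f₁ t * Complex.exp (ψ t * I) * wave (normPhase φ) N t)
      + (1 / 2 : ℂ) * (f₁ t * Complex.exp ((-ψ t : ℝ) * I) * wave (normPhase φ) (-N) t) := by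
    intro t
    have hθt : θ t = ψ t + 2 * Real.pi * N * normPhase φ t := by
      have := hφ.eq_normPhase t
      rw [hN] at this
      simp only [hψ, phaseError]
      linarith
    rw [hs.eq, hθt, wave_eq_exp_ofReal_mul_I, wave_eq_exp_ofReal_mul_I, mul_assoc (f₁ t : ℂ),
      mul_assoc (f₁ t : ℂ), ← Complex.exp_add, ← Complex.exp_add]
    push_cast
    rw [Complex.cos]
    ring_nf
  have hdem := fun {c₁ σ : ℂ} (h1 : ‖c₁‖ = 1) (h2 : ‖σ‖ = 1) =>
    norm_demodulation_sub_le hφ.isWarp hN0 (Complex.continuous_ofReal.comp hs.continuous₀)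
    (Z₁ := fun t => f₁ t * Complex.exp (ψ t * I))
    (Z₂ := fun t => f₁ t * Complex.exp ((-ψ t : ℝ) * I)) (by fun_prop)
    (fun t => by simp only [hs.periodic₁ t, hexp1 t]) (by fun_prop)
    (fun t => by simp only [hs.periodic₁ t, hexp2 t]) hf t₀ t₁ t₂ h1 h2 t
  have h4 : 4 * (ε * δ / 4) = ε * δ := by ring
  rw [h4] at hdem
  constructor
  · rw [envA_eq hN]
    refine (abs_re_sub_le _ _).trans (le_of_eq_of_le ?_ (hdem (c₁ := 1) (σ := 1) (by simp) (by simp)))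
    congr 2
    push_cast
    rw [Complex.cos]
    ring
  · rw [envB_eq hN]
    refine (abs_re_sub_le _ _).trans
      (le_of_eq_of_le ?_ (hdem (c₁ := -I) (σ := -1) (by simp) (by simp)))
    congr 2
    push_cast
    rw [Complex.sin]
    ring

/-! ### Regularity of the extracted envelopes -/

/-- The extracted envelopes are trigonometric polynomials in the coordinate `φ̄`. -/
theorem exists_re_trigPoly {φ : ℝ → ℝ} {N : ℤ} (hN : 0 < N) (e : ℤ → ℂ) : ∃ d : ℤ → ℂ, ∀ t,
    (∑' k : ℤ, e k * cutoff ((k : ℝ) / (N : ℝ)) * wave (normPhase φ) k t).re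
      = (∑ k ∈ lowIndices N, d k * wave (normPhase φ) k t).re := by
  refine ⟨e, fun t => ?_⟩
  rw [tsum_eq_sum (s := lowIndices N)]
  · refine congrArg _ (Finset.sum_congr rfl fun k hk => ?_)
    rw [cutoff_div_intCast hN, if_pos hk, mul_one]
  · intro k hk
    rw [cutoff_div_intCast hN, if_neg hk, mul_zero, zero_mul]

/-- A periodic `C¹` function. -/
structure IsSmoothPeriodic (g : ℝ → ℝ) : Prop where
  differentiable : Differentiable ℝ g
  continuous_deriv : Continuous (deriv g)
  periodic : Function.Periodic g 1

theorem isSmoothPeriodic_re_trigPoly {u : ℝ → ℝ} (hu : IsWarp u) (s : Finset ℤ) (d : ℤ → ℂ) :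
    IsSmoothPeriodic fun t => (∑ k ∈ s, d k * wave u k t).re := by
  have hd : ∀ t, HasDerivAt (fun t => (∑ k ∈ s, d k * wave u k t).re)
      (∑ k ∈ s, d k * (wave u k t * (2 * Real.pi * I * k * (deriv u t : ℝ)))).re t := fun t =>
    Complex.reCLM.hasFDerivAt.comp_hasDerivAt t
      (HasDerivAt.fun_sum fun k _ => (hu.hasDerivAt_wave k t).const_mul (d k))
  refine ⟨fun t => (hd t).differentiableAt, ?_, fun t => ?_⟩
  · rw [funext fun t => (hd t).deriv]
    refine Complex.continuous_re.comp (continuous_finsetSum _ fun k _ => ?_)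
    have := hu.continuous_wave k
    have := hu.continuous_deriv
    fun_prop
  · exact congrArg _ (Finset.sum_congr rfl fun k _ => by rw [hu.wave_periodic k t])

theorem isSmoothPeriodic_envA {M : ℕ} {φ : ℝ → ℝ} (hφ : IsPhase M φ) {N : ℤ}
    (hN : numPeriods φ = N) (f : ℝ → ℝ) : IsSmoothPeriodic (envA f φ) := by
  have hN0 : 0 < N := by
    have := hφ.numPeriods_pos
    rw [hN] at this
    exact_mod_cast this
  obtain ⟨d, hd⟩ := exists_re_trigPoly (φ := φ) hN0 _
  rw [funext (envA_eq hN), funext hd]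
  exact isSmoothPeriodic_re_trigPoly hφ.isWarp _ d

theorem isSmoothPeriodic_envB {M : ℕ} {φ : ℝ → ℝ} (hφ : IsPhase M φ) {N : ℤ}
    (hN : numPeriods φ = N) (f : ℝ → ℝ) : IsSmoothPeriodic (envB f φ) := by
  have hN0 : 0 < N := by
    have := hφ.numPeriods_pos
    rw [hN] at this
    exact_mod_cast this
  obtain ⟨d, hd⟩ := exists_re_trigPoly (φ := φ) hN0 _
  rw [funext (envB_eq hN), funext hd]
  exact isSmoothPeriodic_re_trigPoly hφ.isWarp _ d

/-! ### The angle of the envelopes -/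

/-- Integration by parts trades the size of `p'` for that of `p` at the price of `2π|k|`, harmless
in a fixed band. At `k = 0` periodicity makes the coefficient vanish. -/
theorem norm_physCoeff_le_of_hasDerivAt {p p' : ℝ → ℝ} (hp : Function.Periodic p 1)
    (hd : ∀ t, HasDerivAt p (p' t) t) (hc : Continuous p') {K : ℝ} (hK : ∀ t, |p t| ≤ K) (k : ℤ) :
    ‖physCoeff p' k‖ ≤ |(k : ℝ)| * (2 * Real.pi * K) := by
  have hcc : Continuous fun t => (p' t : ℂ) := Complex.continuous_ofReal.comp hc
  rcases eq_or_ne k 0 with rfl | hk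
  · have h : physCoeff p' 0 = ((∫ t in (0 : ℝ)..1, p' t : ℝ) : ℂ) := by
      rw [physCoeff, fourierCoeffOn_zero_one_eq, ← intervalIntegral.integral_ofReal]
      simp
    rw [h, intervalIntegral.integral_eq_sub_of_hasDerivAt (fun t _ => hd t)
      (hc.intervalIntegrable _ _)]
    have := hp 0
    rw [zero_add] at this
    simp [this]
  · have h1 := norm_fourierCoeffOn_of_hasDerivAt (g := fun t => (p t : ℂ))
      (fun t => by simp only [hp t]) (fun t => (hd t).ofReal_comp) hcc hk
    have h2 : ‖physCoeff p k‖ ≤ K := by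
      rw [physCoeff_eq_warpCoeff]
      exact norm_warpCoeff_le IsWarp.id (fun t _ => by simpa using hK t) k
    have hk' : 0 < 2 * Real.pi * |(k : ℝ)| := by
      have : (0 : ℝ) < |(k : ℝ)| := abs_pos.2 (by exact_mod_cast hk)
      positivity
    have h3 : ‖physCoeff p' k‖ = 2 * Real.pi * |(k : ℝ)| * ‖physCoeff p k‖ := by
      unfold physCoeff
      rw [h1, mul_inv_cancel_left₀ hk'.ne']
    rw [h3]
    nlinarith [mul_le_mul_of_nonneg_left h2 hk'.le]

theorem abs_arctan_le (x : ℝ) : |Real.arctan x| ≤ |x| := by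
  have h : ∀ y : ℝ, 0 ≤ y → Real.arctan y ≤ y := fun y hy => by
    have := Real.le_tan (Real.arctan_nonneg.2 hy) (Real.arctan_lt_pi_div_two y)
    rwa [Real.tan_arctan] at this
  rcases le_total 0 x with hx | hx
  · rw [abs_of_nonneg hx, abs_of_nonneg (Real.arctan_nonneg.2 hx)]
    exact h x hx
  · rw [abs_of_nonpos hx, abs_of_nonpos (Real.arctan_le_zero.2 hx), ← Real.arctan_neg]
    exact h (-x) (neg_nonneg.2 hx)

/-- If `(a, b)` is close to `f₁ (cos ψ, sin ψ)`, then the Fourier coefficients of the derivative of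
its angle are close to those of `ψ'`. -/
theorem norm_physCoeff_angleDeriv_sub_le {a b ψ ψ' f₁ : ℝ → ℝ} (ha : IsSmoothPeriodic a)
    (hb : IsSmoothPeriodic b) (hψ : ∀ t, HasDerivAt ψ (ψ' t) t) (hψ' : Continuous ψ')
    (hcos : Function.Periodic (fun t => Real.cos (ψ t)) 1)
    (hsin : Function.Periodic (fun t => Real.sin (ψ t)) 1) {κ e : ℝ} (hκ : 0 < κ)
    (hf₁ : ∀ t, κ ≤ f₁ t) (he : 4 * e ≤ κ) (hae : ∀ t, |a t - f₁ t * Real.cos (ψ t)| ≤ e)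
    (hbe : ∀ t, |b t - f₁ t * Real.sin (ψ t)| ≤ e) :
    (∀ t, 0 < a t ^ 2 + b t ^ 2) ∧ Continuous (angleDeriv a b) ∧
      ∀ k : ℤ, ‖physCoeff (fun t => angleDeriv a b t - ψ' t) k‖
        ≤ |(k : ℝ)| * (2 * Real.pi * (4 * e / κ)) := by
  have he0 : 0 ≤ e := (abs_nonneg _).trans (hae 0)
  -- `(U, V)` is `(a, b)` rotated by `-ψ`. It stays in the right half-plane, with `U ≥ κ - 2e ≥ κ /
  -- 2` and `|V| ≤ 2e`, so its angle is a genuine periodic `arctan` bounded by `4e / κ`.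
  set U : ℝ → ℝ := fun t => a t * Real.cos (ψ t) + b t * Real.sin (ψ t) with hU
  set V : ℝ → ℝ := fun t => b t * Real.cos (ψ t) - a t * Real.sin (ψ t) with hV
  have hprod : ∀ {x y : ℝ}, |x| ≤ e → |y| ≤ 1 → |x * y| ≤ e := fun hx hy => by
    rw [abs_mul]
    exact (mul_le_of_le_one_right (abs_nonneg _) hy).trans hx
  have hUlow : ∀ t, κ / 2 ≤ U t := by
    intro t
    have h1 := hprod (hae t) (Real.abs_cos_le_one (ψ t))
    have h2 := hprod (hbe t) (Real.abs_sin_le_one (ψ t))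
    have h3 : U t = f₁ t + ((a t - f₁ t * Real.cos (ψ t)) * Real.cos (ψ t)
        + (b t - f₁ t * Real.sin (ψ t)) * Real.sin (ψ t)) := by
      simp only [hU]
      linear_combination f₁ t * Real.sin_sq_add_cos_sq (ψ t)
    rw [h3]
    linarith [(abs_le.1 h1).1, (abs_le.1 h2).1, hf₁ t]
  have hUpos : ∀ t, 0 < U t := fun t => (half_pos hκ).trans_le (hUlow t)
  have hVle : ∀ t, |V t| ≤ 2 * e := by
    intro t
    have h1 := hprod (hbe t) (Real.abs_cos_le_one (ψ t))
    have h2 := hprod (hae t) (Real.abs_sin_le_one (ψ t))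
    have h3 : V t = (b t - f₁ t * Real.sin (ψ t)) * Real.cos (ψ t)
        - (a t - f₁ t * Real.cos (ψ t)) * Real.sin (ψ t) := by
      simp only [hV]
      ring
    rw [h3]
    exact (abs_sub _ _).trans (by linarith)
  have hsq : ∀ t, U t ^ 2 + V t ^ 2 = a t ^ 2 + b t ^ 2 := fun t => by
    simp only [hU, hV]
    linear_combination (a t ^ 2 + b t ^ 2) * Real.sin_sq_add_cos_sq (ψ t)
  have hpos : ∀ t, 0 < a t ^ 2 + b t ^ 2 := fun t => by
    rw [← hsq]
    have := hUpos t
    positivity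
  have hda := fun t => (ha.differentiable t).hasDerivAt
  have hdb := fun t => (hb.differentiable t).hasDerivAt
  have hdU : ∀ t, HasDerivAt U (deriv a t * Real.cos (ψ t) + a t * (-Real.sin (ψ t) * ψ' t)
      + (deriv b t * Real.sin (ψ t) + b t * (Real.cos (ψ t) * ψ' t))) t := fun t =>
    ((hda t).mul (hψ t).cos).add ((hdb t).mul (hψ t).sin)
  have hdV : ∀ t, HasDerivAt V (deriv b t * Real.cos (ψ t) + b t * (-Real.sin (ψ t) * ψ' t)
      - (deriv a t * Real.sin (ψ t) + a t * (Real.cos (ψ t) * ψ' t))) t := fun t =>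
    ((hdb t).mul (hψ t).cos).sub ((hda t).mul (hψ t).sin)
  have hcont : Continuous (angleDeriv a b) := by
    have := ha.differentiable.continuous
    have := hb.differentiable.continuous
    have := ha.continuous_deriv
    have := hb.continuous_deriv
    exact Continuous.div (by fun_prop) (by fun_prop) fun t => (hpos t).ne'
  have hangle : ∀ t, angleDeriv U V t = angleDeriv a b t - ψ' t := by
    intro t
    have := (hpos t).ne'
    unfold angleDeriv
    rw [hsq, (hdU t).deriv, (hdV t).deriv, div_sub' this]
    congr 1
    simp only [hU, hV]
    linear_combination (a t * deriv b t - b t * deriv a t - (a t ^ 2 + b t ^ 2) * ψ' t)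
      * Real.sin_sq_add_cos_sq (ψ t)
  refine ⟨hpos, hcont, norm_physCoeff_le_of_hasDerivAt (p := fun t => Real.arctan (V t / U t))
    (fun t => ?_) (fun t => ?_) (hcont.sub hψ') (fun t => ?_)⟩
  · have h1 := hcos t
    have h2 := hsin t
    simp only at h1 h2
    simp only [hU, hV, ha.periodic t, hb.periodic t, h1, h2]
  · rw [Pi.sub_apply, ← hangle]
    exact hasDerivAt_arctan_div (hdU t).differentiableAt (hdV t).differentiableAt (hUpos t).ne'
  · refine (abs_arctan_le _).trans ?_
    rw [abs_div, abs_of_pos (hUpos t), div_le_div_iff₀ (hUpos t) hκ]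
    nlinarith [hVle t, hUlow t, abs_nonneg (V t)]

/-! ### One step of the iteration -/

/-- One step of the iteration, in terms of the instantaneous frequency. -/
theorem nextPhase_of_small_error {M : ℕ} {θ φ f R : ℝ → ℝ} (hθ : IsPhase M θ) (hφ : IsPhase M φ)
    (hR : IsRealTrig M R) (hR0 : ∫ t in (0 : ℝ)..1, R t = 0)
    (hupd : ∀ t, freqUpdate M f φ t = deriv θ t - deriv φ t + R t)
    (hpos : ∀ t, 0 ≤ deriv θ t + R t) :
    (∀ t, HasDerivAt (nextPhase M f φ) (deriv θ t + R t) t) ∧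
      numPeriods (nextPhase M f φ) = numPeriods θ := by
  have hDc : Continuous fun t => deriv θ t - deriv φ t :=
    hθ.isRealTrig.continuous.sub hφ.isRealTrig.continuous
  have hfc : Continuous (freqUpdate M f φ) := by
    rw [funext hupd]
    exact hDc.add hR.continuous
  have hpd : ∀ t, HasDerivAt (phaseUpdate M f φ) (freqUpdate M f φ t) t := fun t =>
    intervalIntegral.integral_hasDerivAt_right (hfc.intervalIntegrable _ _)
      (hfc.stronglyMeasurableAtFilter _ _) hfc.continuousAt
  have hαd : ∀ α t : ℝ, HasDerivAt (fun s => φ s + α * phaseUpdate M f φ s)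
      (deriv φ t + α * freqUpdate M f φ t) t := fun α t =>
    (hφ.differentiable t).hasDerivAt.add ((hpd t).const_mul α)
  -- The value `α = 1` is admissible because the full step has derivative `θ' + R ≥ 0`. The value `α
  -- = 0` only shows that the set is nonempty.
  have hone : stepLength M f φ = 1 := by
    refine le_antisymm (csSup_le ⟨0, ⟨⟨le_rfl, zero_le_one⟩, fun t _ => ?_⟩⟩ fun α h => h.1.2)
      (le_csSup ⟨1, fun α h => h.1.2⟩ ⟨⟨zero_le_one, le_rfl⟩, fun t _ => ?_⟩)
    · rw [(hαd 0 t).deriv, zero_mul, add_zero]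
      exact (hφ.deriv_pos t).le
    · rw [(hαd 1 t).deriv, hupd, one_mul]
      linarith [hpos t]
  have hnd : ∀ t, HasDerivAt (nextPhase M f φ) (deriv θ t + R t) t := by
    intro t
    have h := hαd (stepLength M f φ) t
    rw [hupd, hone] at h
    have h2 : deriv θ t + R t = deriv φ t + 1 * (deriv θ t - deriv φ t + R t) := by ring
    rw [h2]
    have h3 : nextPhase M f φ = fun s => φ s + 1 * phaseUpdate M f φ s := by
      funext s
      rw [nextPhase, hone]
    rw [h3]
    exact h
  refine ⟨hnd, ?_⟩
  have hint := intervalIntegral.integral_eq_sub_of_hasDerivAt (a := 0) (b := 1)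
    (fun t _ => hnd t) ((hθ.isRealTrig.continuous.add hR.continuous).intervalIntegrable _ _)
  rw [intervalIntegral.integral_add (hθ.isRealTrig.continuous.intervalIntegrable _ _)
    (hR.continuous.intervalIntegrable _ _), hR0, add_zero, hθ.integral_deriv] at hint
  have := Real.pi_pos
  rw [numPeriods, ← hint]
  field_simp

/-- An admissible guess for the phase `θ`. -/
structure IsGuess (M : ℕ) (θ φ : ℝ → ℝ) : Prop where
  differentiable : Differentiable ℝ φ
  isRealTrig : IsRealTrig M (deriv φ)
  exists_int : ∃ N : ℤ, numPeriods φ = N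
  error_le : fourierL1 (deriv fun t => φ t - θ t) ≤ ENNReal.ofReal (Real.pi * M / 2)

/-- One step of the iteration from an admissible guess. -/
theorem exists_step (M₀ M₁ : ℕ) {c κ : ℝ} (hc : 0 < c) (hκ : 0 < κ) (C : ℝ) :
    ∃ η : ℝ, 0 < η ∧ ∀ θ f₀ f₁ f φ : ℝ → ℝ, IsSignal M₀ M₁ c κ C θ f₀ f₁ f → IsGuess M₀ θ φ →
      η ≤ numPeriods θ →
      (IsPhase M₀ φ ∧ ∀ t, 0 < envA f φ t ^ 2 + envB f φ t ^ 2) ∧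
      IsGuess M₀ θ (nextPhase M₀ f φ) ∧
      fourierL1 (deriv fun t => nextPhase M₀ f φ t - θ t)
        ≤ 2⁻¹ * fourierL1 (deriv fun t => φ t - θ t) ∧
      ∀ t, |envA f φ t - f₁ t * Real.cos (phaseError θ φ t)|
            ≤ (fourierL1 (deriv fun t => φ t - θ t)).toReal ∧
          |envB f φ t - f₁ t * Real.sin (phaseError θ φ t)|
            ≤ (fourierL1 (deriv fun t => φ t - θ t)).toReal := by
  have hpi := Real.pi_pos
  -- The summands of `Q` serve, in order: `ε ≤ 1`; the condition `4 ε δ ≤ κ`, given `δ ≤ π M₀ / 2`;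
  -- and the contraction factor `1/2`. The last needs `2M₀ + 1` twice, for the sup bound of the
  -- projection and for passing from the sup norm to the `ℓ¹` norm of coefficients.
  set Q : ℝ := κ + 2 * Real.pi * M₀ + 16 * Real.pi * M₀ * (2 * M₀ + 1) ^ 2 with hQ
  have hQpos : 0 < Q := by positivity
  set ε : ℝ := κ / Q with hε
  have hεpos : 0 < ε := div_pos hκ hQpos
  have hεQ : ε * Q = κ := div_mul_cancel₀ _ hQpos.ne'
  have hε1 : ε ≤ 1 := by
    rw [hε, div_le_one hQpos, hQ]
    have : 0 ≤ 2 * Real.pi * M₀ + 16 * Real.pi * M₀ * (2 * M₀ + 1) ^ 2 := by positivity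
    linarith
  have hε2 : ε * (2 * Real.pi * M₀) ≤ κ := by
    rw [← hεQ]
    refine mul_le_mul_of_nonneg_left ?_ hεpos.le
    have : 0 ≤ 16 * Real.pi * M₀ * (2 * (M₀ : ℝ) + 1) ^ 2 := by positivity
    linarith
  have hε3 : ε * (16 * Real.pi * M₀ * (2 * M₀ + 1) ^ 2) ≤ κ := by
    rw [← hεQ]
    refine mul_le_mul_of_nonneg_left ?_ hεpos.le
    have : 0 ≤ 2 * Real.pi * M₀ := by positivity
    linarith
  obtain ⟨η, hη⟩ := exists_envelope_close M₀ M₁ hc κ C hεpos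
  refine ⟨max η (M₀ / c + 1), lt_max_of_lt_right (by positivity), ?_⟩
  intro θ f₀ f₁ f φ hs hg hL
  have hθ := hs.isPhase
  have hL1 : η ≤ numPeriods θ := (le_max_left _ _).trans hL
  have hL2 : M₀ / c + 1 ≤ numPeriods θ := (le_max_right _ _).trans hL
  have hdiff : (deriv fun t => φ t - θ t) = fun t => deriv φ t - deriv θ t :=
    funext fun t => ((hg.differentiable t).hasDerivAt.sub (hθ.differentiable t).hasDerivAt).deriv
  have hDtrig : IsRealTrig M₀ fun t => deriv φ t - deriv θ t := hg.isRealTrig.sub hθ.isRealTrig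
  set δ := lowL1 M₀ fun t => deriv φ t - deriv θ t with hδdef
  have hδ0 : 0 ≤ δ := lowL1_nonneg _ _
  have hF : fourierL1 (deriv fun t => φ t - θ t) = ENNReal.ofReal δ := by
    rw [hdiff, hDtrig.fourierL1_eq]
  have hδM : δ ≤ Real.pi * M₀ / 2 := by
    have := hg.error_le
    rwa [hF, ENNReal.ofReal_le_ofReal_iff (by positivity)] at this
  have hD : ∀ t, |deriv θ t - deriv φ t| ≤ δ := fun t => by
    rw [abs_sub_comm]
    exact hDtrig.abs_le_lowL1 t
  -- This is where many periods force positivity: `θ' ≥ 2πcL ≥ 2π(M₀ + c)` dominates the admissible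
  -- error, hence also `R`, so both `φ'` and `θ' + R` are positive.
  have hθlow : ∀ t, Real.pi * M₀ / 2 < deriv θ t := by
    intro t
    have h1 := hs.le_deriv t
    have hLpos := hθ.numPeriods_pos
    rw [hθ.deriv_normPhase, le_div_iff₀ (by positivity)] at h1
    refine lt_of_lt_of_le ?_ h1
    have h2 : M₀ + c ≤ c * numPeriods θ := by
      have := mul_le_mul_of_nonneg_left hL2 hc.le
      rwa [mul_add, mul_div_cancel₀ _ hc.ne', mul_one] at this
    have h3 := mul_le_mul_of_nonneg_left h2 hpi.le
    have h4 : 0 < Real.pi * c := by positivity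
    have h5 : 0 ≤ Real.pi * M₀ := by positivity
    linarith
  have hφ : IsPhase M₀ φ := ⟨hg.differentiable, hg.isRealTrig, fun t => by
    linarith [(abs_le.1 (hD t)).2, hθlow t]⟩
  obtain ⟨N, hN⟩ := hg.exists_int
  obtain ⟨L, hLint⟩ := hs.exists_int
  have hclose := hη θ f₀ f₁ f φ δ hs hφ ⟨N, hN⟩ hD hδM hL1
  have hψd : ∀ t, HasDerivAt (phaseError θ φ) (deriv θ t - deriv φ t) t := fun t =>
    ((hθ.differentiable t).hasDerivAt.sub (hφ.differentiable t).hasDerivAt).add_const _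
  have hDc : Continuous fun t => deriv θ t - deriv φ t :=
    hθ.isRealTrig.continuous.sub hφ.isRealTrig.continuous
  have hψper : ∀ t, phaseError θ φ (t + 1)
      = phaseError θ φ t + (L - N : ℤ) * (2 * Real.pi) := by
    intro t
    simp only [phaseError, hθ.map_add_one, hφ.map_add_one, hLint, hN]
    push_cast
    ring
  obtain ⟨hab, hqc, hcoef⟩ := norm_physCoeff_angleDeriv_sub_le
    (isSmoothPeriodic_envA hφ hN f) (isSmoothPeriodic_envB hφ hN f) hψd hDc
    (fun t => by simp only [hψper, Real.cos_add_int_mul_two_pi])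
    (fun t => by simp only [hψper, Real.sin_add_int_mul_two_pi]) hκ hs.le_envelope
    (e := ε * δ) (by
      have := mul_le_mul_of_nonneg_left hδM hεpos.le
      linarith)
    (fun t => (hclose t).1) (fun t => (hclose t).2)
  set q := angleDeriv (envA f φ) (envB f φ) with hq
  set R := projV M₀ fun t => q t - (deriv θ t - deriv φ t) with hR
  have hRtrig : IsRealTrig M₀ R := isRealTrig_projV _ _
  have hR0 : ∫ t in (0 : ℝ)..1, R t = 0 := integral_projV_eq_zero (by simpa using hcoef 0)
  have hupd : ∀ t, freqUpdate M₀ f φ t = deriv θ t - deriv φ t + R t := by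
    intro t
    have h1 := projV_add M₀ hDc (hqc.sub hDc) t
    simp only [Pi.sub_apply, add_sub_cancel] at h1
    rw [(hθ.isRealTrig.sub hφ.isRealTrig).projV_eq] at h1
    exact h1
  have hRle : lowL1 M₀ R ≤ δ / 2 := by
    refine (lowL1_le (abs_projV_le hcoef (by positivity))).trans ?_
    have h1 := mul_le_mul_of_nonneg_right hε3 hδ0
    rw [← mul_div_assoc, ← mul_div_assoc, ← mul_div_assoc, ← mul_div_assoc, div_le_iff₀ hκ]
    linarith
  have hRpos : ∀ t, 0 < deriv θ t + R t := fun t => by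
    linarith [(abs_le.1 (hRtrig.abs_le_lowL1 t)).1, hθlow t]
  obtain ⟨hnd, hnL⟩ := nextPhase_of_small_error hθ hφ hRtrig hR0 hupd fun t => (hRpos t).le
  have hnext : (deriv fun t => nextPhase M₀ f φ t - θ t) = R := funext fun t => by
    rw [((hnd t).fun_sub (hθ.differentiable t).hasDerivAt).deriv, add_sub_cancel_left]
  have hhalf : fourierL1 (deriv fun t => nextPhase M₀ f φ t - θ t)
      ≤ 2⁻¹ * fourierL1 (deriv fun t => φ t - θ t) := by
    rw [hF, hnext, hRtrig.fourierL1_eq]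
    refine (ENNReal.ofReal_le_ofReal hRle).trans (le_of_eq ?_)
    rw [div_eq_inv_mul, ENNReal.ofReal_mul (by norm_num), ENNReal.ofReal_inv_of_pos two_pos,
      ENNReal.ofReal_ofNat]
  refine ⟨⟨hφ, hab⟩, ⟨fun t => (hnd t).differentiableAt, ?_, ⟨L, hnL.trans hLint⟩,
    hhalf.trans ((mul_le_of_le_one_left' (by simp)).trans hg.error_le)⟩, hhalf, fun t => ?_⟩
  · rw [funext fun t => (hnd t).deriv]
    exact hθ.isRealTrig.add hRtrig
  · rw [hF, ENNReal.toReal_ofReal hδ0]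
    have h1 : ε * δ ≤ δ := mul_le_of_le_one_left hδ0 hε1
    exact ⟨(hclose t).1.trans h1, (hclose t).2.trans h1⟩

/-! ### Convergence of the iteration -/

theorem phaseIter_succ (M : ℕ) (f θ₀ : ℝ → ℝ) (m : ℕ) :
    phaseIter M f θ₀ (m + 1) = nextPhase M f (phaseIter M f θ₀ m) :=
  Function.iterate_succ_apply' _ _ _

/-- Since `θ` is `phaseError θ φ` plus the carrier phase `y`, the addition formula for the cosine
gives the mode that exact envelopes would produce, and each envelope error enters with a factor of
modulus at most one. -/
theorem abs_sub_extractedMode_sub_le {M : ℕ} {θ φ f f₀ f₁ : ℝ → ℝ} (hφ : IsPhase M φ)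
    (hf : ∀ t, f t = f₀ t + f₁ t * Real.cos (θ t)) {e : ℝ} {t : ℝ}
    (ha : |envA f φ t - f₁ t * Real.cos (phaseError θ φ t)| ≤ e)
    (hb : |envB f φ t - f₁ t * Real.sin (phaseError θ φ t)| ≤ e) :
    |f₀ t - (f t - extractedMode f φ t)| ≤ 2 * e := by
  set y := 2 * Real.pi * numPeriods φ * normPhase φ t with hy
  have hθ : θ t = phaseError θ φ t + y := by
    have := hφ.eq_normPhase t
    simp only [phaseError]
    linarith
  have h : f₀ t - (f t - extractedMode f φ t)
      = (envA f φ t - f₁ t * Real.cos (phaseError θ φ t)) * Real.cos y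
        - (envB f φ t - f₁ t * Real.sin (phaseError θ φ t)) * Real.sin y := by
    rw [hf, hθ, Real.cos_add, extractedMode]
    ring
  rw [h]
  refine (abs_sub _ _).trans ?_
  rw [abs_mul, abs_mul]
  have h1 := (mul_le_of_le_one_right (abs_nonneg _) (Real.abs_cos_le_one y)).trans ha
  have h2 := (mul_le_of_le_one_right (abs_nonneg _) (Real.abs_sin_le_one y)).trans hb
  linarith

/-- The modulus is 1-Lipschitz on the plane, and the point `r (cos ψ, sin ψ)` has modulus `r`. -/
theorem abs_extractedEnvelope_sub_le {φ f : ℝ → ℝ} {r ψ e t : ℝ} (hr : 0 ≤ r)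
    (ha : |envA f φ t - r * Real.cos ψ| ≤ e) (hb : |envB f φ t - r * Real.sin ψ| ≤ e) :
    |r - extractedEnvelope f φ t| ≤ 2 * e := by
  have h1 : extractedEnvelope f φ t = ‖(⟨envA f φ t, envB f φ t⟩ : ℂ)‖ := by
    rw [extractedEnvelope, Complex.norm_eq_sqrt_sq_add_sq]
  have h2 : r = ‖(⟨r * Real.cos ψ, r * Real.sin ψ⟩ : ℂ)‖ := by
    rw [Complex.norm_eq_sqrt_sq_add_sq, mul_pow, mul_pow, ← mul_add, Real.cos_sq_add_sin_sq,
      mul_one, Real.sqrt_sq hr]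
  have h3 := (abs_norm_sub_norm_le (⟨envA f φ t, envB f φ t⟩ : ℂ)
    ⟨r * Real.cos ψ, r * Real.sin ψ⟩).trans (Complex.norm_le_abs_re_add_abs_im _)
  rw [← h2, ← h1, Complex.sub_re, Complex.sub_im] at h3
  rw [abs_sub_comm]
  linarith

end SparseTF

theorem mainTheorem1 (M₀ M₁ : ℕ) (c κ C : ℝ) (hc : 0 < c) (hκ : 0 < κ) :
    ∃ η₀ : ℝ, 0 < η₀ ∧
      ∀ (θ f₀ f₁ f : ℝ → ℝ),
        -- the periodic signal and its decomposition
        Function.Periodic f 1 →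
        (∀ t, f t = f₀ t + f₁ t * Real.cos (θ t)) →
        Continuous f₀ → Function.Periodic f₀ 1 →
        Continuous f₁ → Function.Periodic f₁ 1 →
        Differentiable ℝ θ →
        (∀ t, 0 < f₁ t) → (∀ t, 0 < deriv θ t) →
        -- sparsity
        (fun t => ((deriv θ t : ℝ) : ℂ)) ∈ trigSpan M₀ →
        (∀ k : ℤ, (M₁ : ℤ) < |k| → phaseCoeff θ f₀ k = 0 ∧ phaseCoeff θ f₁ k = 0) →
        -- the quantities that the threshold may depend on, besides `M₀` and `M₁`
        (∀ t, c ≤ deriv (normPhase θ) t) →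
        (∀ t, κ ≤ f₁ t) →
        (∀ k : ℤ, ‖phaseCoeff θ f₀ k‖ ≤ C ∧ ‖phaseCoeff θ f₁ k‖ ≤ C) →
        -- scale separation
        η₀ ≤ numPeriods θ →
        ∀ θ₀ : ℝ → ℝ,
          -- the initial guess
          Differentiable ℝ θ₀ →
          (fun t => ((deriv θ₀ t : ℝ) : ℂ)) ∈ trigSpan M₀ →
          (∃ N : ℤ, numPeriods θ₀ = N) →
          fourierL1 (deriv (fun t => θ₀ t - θ t)) ≤ ENNReal.ofReal (Real.pi * M₀ / 2) →
          -- the iteration is well defined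
          (∀ m : ℕ, ∀ t : ℝ, 0 < deriv (phaseIter M₀ f θ₀ m) t ∧
            0 < envA f (phaseIter M₀ f θ₀ m) t ^ 2 + envB f (phaseIter M₀ f θ₀ m) t ^ 2) ∧
          -- each step halves the error of the instantaneous frequency
          (∀ m : ℕ, fourierL1 (deriv (fun t => phaseIter M₀ f θ₀ (m + 1) t - θ t)) ≤
            2⁻¹ * fourierL1 (deriv (fun t => phaseIter M₀ f θ₀ m t - θ t))) ∧
          -- convergence to the exact decomposition
          Filter.Tendsto (fun m : ℕ => fourierL1 (deriv (fun t => phaseIter M₀ f θ₀ m t - θ t)))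
            Filter.atTop (nhds 0) ∧
          TendstoUniformly (fun (m : ℕ) t => f t - extractedMode f (phaseIter M₀ f θ₀ m) t)
            f₀ Filter.atTop ∧
          TendstoUniformly (fun (m : ℕ) => extractedEnvelope f (phaseIter M₀ f θ₀ m))
            f₁ Filter.atTop := by
  obtain ⟨η, hηpos, hη⟩ := exists_step M₀ M₁ hc hκ C
  refine ⟨η, hηpos, ?_⟩
  intro θ f₀ f₁ f hf heq hc₀ hp₀ hc₁ hp₁ hθd hf₁ hθpos hθV hsp hcθ hκf hC hL θ₀ hd₀ hV₀ hN₀ hE₀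
  have hθ : IsPhase M₀ θ := ⟨hθd, hθV, hθpos⟩
  have hs : IsSignal M₀ M₁ c κ C θ f₀ f₁ f :=
    ⟨hθ, exists_numPeriods_eq_intCast hθ hf heq hp₀ hp₁ hf₁, heq, hc₀, hp₀, hc₁, hp₁, hsp, hcθ,
      hκf, hC⟩
  have hguess : ∀ m, IsGuess M₀ θ (phaseIter M₀ f θ₀ m) := by
    intro m
    induction m with
    | zero => exact ⟨hd₀, hV₀, hN₀, hE₀⟩
    | succ m ih =>
      rw [phaseIter_succ]
      exact (hη θ f₀ f₁ f _ hs ih hL).2.1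
  have hstep := fun m => hη θ f₀ f₁ f _ hs (hguess m) hL
  set E : ℕ → ENNReal := fun m => fourierL1 (deriv fun t => phaseIter M₀ f θ₀ m t - θ t) with hE
  have hhalf : ∀ m, E (m + 1) ≤ 2⁻¹ * E m := by
    intro m
    simp only [hE, phaseIter_succ]
    exact (hstep m).2.2.1
  have hgeom : ∀ m, E m ≤ 2⁻¹ ^ m * E 0 := by
    intro m
    induction m with
    | zero => simp
    | succ m ih =>
      refine (hhalf m).trans ?_
      rw [pow_succ', mul_assoc]
      gcongr
  have hfin : ∀ m, E m ≠ ⊤ := fun m => ((hguess m).error_le.trans_lt ENNReal.ofReal_lt_top).ne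
  have hE0 : Filter.Tendsto E Filter.atTop (nhds 0) := by
    refine tendsto_of_tendsto_of_tendsto_of_le_of_le tendsto_const_nhds ?_
      (fun _ => zero_le) hgeom
    have h := ENNReal.Tendsto.mul_const (b := E 0)
      (ENNReal.tendsto_pow_atTop_nhds_zero_of_lt_one (r := 2⁻¹) (by simp)) (Or.inr (hfin 0))
    rwa [zero_mul] at h
  have hreal : Filter.Tendsto (fun m => 2 * (E m).toReal) Filter.atTop (nhds 0) := by
    have := ((ENNReal.tendsto_toReal ENNReal.zero_ne_top).comp hE0).const_mul 2
    simpa using this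
  -- The envelope errors are at most `E m` at every `t`, and both the mode and the modulus lose a
  -- factor `2`. The bound does not involve `t`, so convergence is uniform.
  have hunif : ∀ (F : ℕ → ℝ → ℝ) (g : ℝ → ℝ), (∀ m t, |g t - F m t| ≤ 2 * (E m).toReal) →
      TendstoUniformly F g Filter.atTop := by
    intro F g h
    rw [Metric.tendstoUniformly_iff]
    intro ε hε
    filter_upwards [hreal.eventually_lt_const hε] with m hm t
    exact (h m t).trans_lt hm
  exact ⟨fun m t => ⟨(hstep m).1.1.deriv_pos t, (hstep m).1.2 t⟩, hhalf, hE0,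
    hunif _ _ fun m t => abs_sub_extractedMode_sub_le (hstep m).1.1 heq
      ((hstep m).2.2.2 t).1 ((hstep m).2.2.2 t).2,
    hunif _ _ fun m t => abs_extractedEnvelope_sub_le (hf₁ t).le
      ((hstep m).2.2.2 t).1 ((hstep m).2.2.2 t).2⟩
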